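/- **Setting.** Let $n\ge 1$, $0<\lambda\le\Lambda<\infty$, $a\ge 1$, $0<\underline\sigma\le\overline\sigma<2$, and let $\varphi:(0,\infty)\to(0,\infty)$ be a measurable function satisfying $$a^{-1}\Big(\frac{s}{r}\Big)^{\underline\sigma}\le\frac{\varphi(s)}{\varphi(r)}\le a\Big(\frac{s}{r}\Big)^{\overline\sigma}\qquad\text{for all }0<r\le s<\infty .$$ Put $$C_\varphi=\Big(\int_{\mathbb R^n}\frac{1-\cos y_1}{|y|^n\varphi(|y|)}\,dy\Big)^{-1},\qquad \underline C(t)=\int_0^t\frac{r}{\varphi(r)}\,dr,\qquad \overline C(t)=\int_t^\infty\frac{dr}{r\varphi(r)},$$ and $\underline C=\underline C(1)$, $\overline C=\overline C(1)$. Let $\mathcal L_0$ be the class of operators $Lu(x)=\int_{\mathbb R^n}\big(u(x+y)+u(x-y)-2u(x)\big)K(y)\,dy$ with measurable symmetric kernels $K$ such that $\int\frac{|y|^2}{1+|y|^2}K(y)\,dy<\infty$ and $$C_\varphi\frac{\lambda}{|y|^n\varphi(|y|)}\le K(y)\le C_\varphi\frac{\Lambda}{|y|^n\varphi(|y|)}\qquad(y\ne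 0),$$ and let $\mathcal M^+u(x)=\sup_{L\in\mathcal L_0}Lu(x)$. For an open set $\Omega$ and a function $g$ on $\Omega$, a bounded measurable function $u:\mathbb R^n\to\mathbb R$ that is upper semicontinuous in $\overline\Omega$ satisfies $\mathcal M^+u\ge g$ in $\Omega$ in the viscosity sense if, whenever $x\in\Omega$, $N\subset\Omega$ is a bounded open neighbourhood of $x$ and $\psi$ is a $C^2$ function with $\psi(x)=u(x)$ and $\psi>u$ in $N\setminus\{x\}$, the function $v$ equal to $\psi$ in $N$ and to $u$ in $\mathbb R^n\setminus N$ satisfies $\mathcal M^+v(x)\ge g(x)$. Let $R>0$ and $B_R=B_R(0)$. The concave envelope $\Gamma$ of $u^+$ in $B_{3R}$ is $\Gamma(x)=\min\{p(x): p\text{ affine},\ p\ge u^+\text{ in }B_{3R}\}$ for $x\in B_{3R}$ and $\Gamma=0$ outside $B_{3R}$. For $S\subset B_{3R}$, $\nabla\Gamma(S)$ is the union over $x\in S$ of the superdifferentials $\{p:\Gamma(y)\le\Gamma(x)+p\cdot(y-x)\ \forall y\in B_{3R}\}$. The contact set is $\Sigma=\{x\in B_R:u(x)=\Gamma(x)\}$.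 Let $$r_0=\rho_0\,2^{-1/(2-\underline\sigma)}R,\qquad \rho_0=2^{-8}n^{-1}.$$ For a cube $\mathcal Q$ and $t>0$, $t\mathcal Q$ is the cube with the same centre and $t$ times the side length. **Theorem (ABP estimate).** There are constants $\mu_n\in(0,1)$, depending only on $n$, and $C>0$, depending only on $n$, $\lambda$ and $a$, such that the following holds. Let $f$ be a real function, bounded above in $B_R$, and suppose that $\mathcal M^+u\ge -f$ in $B_R$ in the viscosity sense, that $u\le 0$ in $\mathbb R^n\setminus B_R$, and that $u$ is positive at some point. Then there is a finite family of pairwise disjoint open cubes $\mathcal Q_1,\dots,\mathcal Q_m$ with diameters $d_j\le r_0$ such that, with $M_j=\sup_{\overline{\mathcal Q}_j\cap B_R}f$, 1. $\Sigma\cap\overline{\mathcal Q}_j\ne\emptyset$ for every $j$; 2. $\Sigma\subset\bigcup_{j=1}^m\overline{\mathcal Q}_j$; 3. $|\nabla\Gamma(\overline{\mathcal Q}_j)|\le C\Big(\dfrac{\underline C+\overline C}{\underline C(r_0)}\,M_j\Big)^n|\mathcal Q_j|$ for every $j$; 4. $\Big|\Big\{y\in 32\sqrt n\,\mathcal Q_j:\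 u(y)>\Gamma(y)-C\,\dfrac{\underline C+\overline C}{\underline C(r_0)}\,M_j\,d_j^2\Big\}\Big|\ge\mu_n|\mathcal Q_j|$ for every $j$. -/

import Mathlib

namespace NonlocalABP

/-- `ℝⁿ` with its Euclidean norm. -/
abbrev E (n : ℕ) : Type := EuclideanSpace ℝ (Fin n)

/-- The weak scaling condition for a (measurable) function `φ : (0, ∞) → (0, ∞)` with constants
`a`, `σ₁` (lower exponent) and `σ₂` (upper exponent). Only the values of `φ` on `(0, ∞)` matter. -/
structure WeakScaling (φ : ℝ → ℝ) (a σ₁ σ₂ : ℝ) : Prop where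
  measurable : Measurable (fun r : Set.Ioi (0 : ℝ) => φ r)
  pos : ∀ r, 0 < r → 0 < φ r
  lower : ∀ r R, 0 < r → r ≤ R → a⁻¹ * (R / r) ^ σ₁ ≤ φ R / φ r
  upper : ∀ r R, 0 < r → r ≤ R → φ R / φ r ≤ a * (R / r) ^ σ₂

/-- `∫₀ᴿ r / φ(r) dr`. -/
noncomputable def lowerC (φ : ℝ → ℝ) (R : ℝ) : ℝ :=
  ∫ r in Set.Ioo 0 R, r / φ r

/-- `∫_R^∞ 1 / (r φ(r)) dr`. -/
noncomputable def upperC (φ : ℝ → ℝ) (R : ℝ) : ℝ :=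
  ∫ r in Set.Ioi R, 1 / (r * φ r)

/-- The normalizing constant `C_φ = (∫ (1 - cos y₁) / (|y|ⁿ φ(|y|)) dy)⁻¹`. -/
noncomputable def normConst (n : ℕ) [NeZero n] (φ : ℝ → ℝ) : ℝ :=
  (∫ y : E n, (1 - Real.cos (y 0)) / (‖y‖ ^ n * φ ‖y‖))⁻¹

/-- The second difference `δ(u, x, y) = u(x + y) + u(x - y) - 2 u(x)`. -/
def secondDiff {n : ℕ} (u : E n → ℝ) (x y : E n) : ℝ :=
  u (x + y) + u (x - y) - 2 * u x

/-- The linear operator `L u(x) = ∫ δ(u, x, y) K(y) dy`. -/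
noncomputable def linOp {n : ℕ} (K : E n → ℝ) (u : E n → ℝ) (x : E n) : ℝ :=
  ∫ y, secondDiff u x y * K y

/-- The kernels of the class `𝓛₀`: symmetric, with `∫ |y|² / (1 + |y|²) K(y) dy < ∞`, and comparable
to `C_φ / (|y|ⁿ φ(|y|))` with constants `lam` and `Lam`. -/
structure IsKernel {n : ℕ} [NeZero n] (φ : ℝ → ℝ) (lam Lam : ℝ) (K : E n → ℝ) : Prop where
  measurable : Measurable K
  symm : ∀ y, K (-y) = K y
  integrable : MeasureTheory.Integrable (fun y : E n => ‖y‖ ^ 2 / (1 + ‖y‖ ^ 2) * K y)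
  lower : ∀ y, y ≠ 0 → normConst n φ * (lam / (‖y‖ ^ n * φ ‖y‖)) ≤ K y
  upper : ∀ y, y ≠ 0 → K y ≤ normConst n φ * (Lam / (‖y‖ ^ n * φ ‖y‖))

/-- The maximal operator `𝓜⁺ u(x) = sup_{L ∈ 𝓛₀} L u(x)`. -/
noncomputable def maxOp {n : ℕ} [NeZero n] (φ : ℝ → ℝ) (lam Lam : ℝ) (u : E n → ℝ) (x : E n) : ℝ :=
  sSup {t : ℝ | ∃ K : E n → ℝ, IsKernel φ lam Lam K ∧ t = linOp K u x}

/-- `I u ≥ g` in `Ω` in the viscosity sense: `u` is a bounded (Lebesgue measurable) function on `ℝⁿ`,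
upper semicontinuous in `closure Ω`, and whenever a `C²` function `ψ` touches `u` strictly from above
at `x ∈ Ω` in a bounded open neighbourhood `N ⊆ Ω` of `x`, the function `v` equal to `ψ` in `N` and
to `u` outside `N` satisfies `I v(x) ≥ g(x)`. -/
structure IsViscositySubsolution {n : ℕ} (I : (E n → ℝ) → E n → ℝ) (g : E n → ℝ) (Ω : Set (E n))
    (u : E n → ℝ) : Prop where
  aemeasurable : AEMeasurable u MeasureTheory.volume
  bounded : ∃ M : ℝ, ∀ x, |u x| ≤ M
  usc : UpperSemicontinuousOn u (closure Ω)
  test : ∀ x ∈ Ω, ∀ N : Set (E n), IsOpen N → x ∈ N → Bornology.IsBounded N → N ⊆ Ω →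
    ∀ ψ : E n → ℝ, ContDiff ℝ 2 ψ → ψ x = u x → (∀ y ∈ N \ {x}, u y < ψ y) →
    ∀ v : E n → ℝ, (∀ y ∈ N, v y = ψ y) → (∀ y ∉ N, v y = u y) → g x ≤ I v x

open Classical in
/-- The concave envelope of `u⁺` in the ball `B_{3R}`: the least value of the planes lying above `u⁺`
in `B_{3R}`, and `0` outside `B_{3R}`. -/
noncomputable def concaveEnvelope {n : ℕ} (u : E n → ℝ) (R : ℝ) (x : E n) : ℝ :=
  if x ∈ Metric.ball (0 : E n) (3 * R) then
    sInf {t : ℝ | ∃ (p : E n) (c : ℝ),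
      (∀ y ∈ Metric.ball (0 : E n) (3 * R), max (u y) 0 ≤ inner ℝ p y + c) ∧ t = inner ℝ p x + c}
  else 0

/-- The contact set `{u = Γ} ∩ B_R`. -/
def contactSet {n : ℕ} (u : E n → ℝ) (R : ℝ) : Set (E n) :=
  {x | x ∈ Metric.ball (0 : E n) R ∧ u x = concaveEnvelope u R x}

/-- The image `∇Γ(S)` of `S` under the superdifferential in `U` of a function `Γ` (concave in `U`). -/
def gradImage {n : ℕ} (Γ : E n → ℝ) (U S : Set (E n)) : Set (E n) :=
  {p | ∃ x ∈ S ∩ U, ∀ y ∈ U, Γ y ≤ Γ x + inner ℝ p (y - x)}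

/-- The open cube with centre `c` and side length `s`, with sides parallel to the axes. -/
def cube {n : ℕ} (c : E n) (s : ℝ) : Set (E n) :=
  {y | ∀ i, |y i - c i| < s / 2}

/-- `r₀ = ρ₀ 2^{-1/(2 - σ₁)} R` with `ρ₀ = 2⁻⁸ n⁻¹`. -/
noncomputable def r0 (n : ℕ) (σ₁ R : ℝ) : ℝ :=
  1 / (2 ^ 8 * (n : ℝ)) * (2 : ℝ) ^ (-1 / (2 - σ₁)) * R

/-- The factor `(C̲(1) + C̄(1)) / C̲(r₀)`. -/
noncomputable def scaleFactor (n : ℕ) (φ : ℝ → ℝ) (σ₁ R : ℝ) : ℝ :=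
  (lowerC φ 1 + upperC φ 1) / lowerC φ (r0 n σ₁ R)

end NonlocalABP

open MeasureTheory Set

namespace NonlocalABP

/-! At a contact point `x` a supporting plane of `Γ` touches `u` from above in `B_{3R}`, and since
`u ≤ 0` outside `B_R` all second differences of `u` at `x` are nonpositive. Testing the equation
with this plane plus `ε|y - x|²` on a small ball, and letting `ε → 0`, removes the singular part. On
the rest the lower kernel bound is the relevant one, because the sign of the second difference is
known, so `lam * normConst n φ * ∫ -secondDiff u x y * baseKernel n φ y ≤ f x` away from the origin
(`viscosity_integral_le`). The upper ellipticity constant multiplies only the `ε` term, which is why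
`C` does not depend on it.

Suppose that in every dyadic annulus of radius `s = r₀ / 2 ^ k` around `x` the function `u` dropped
more than `M s²` below the plane on a fixed fraction of the volume. By weak scaling, each annulus
would contribute at least a multiple of `M ∫ r / φ(r) dr` over `(s / 2, s]`. Summed over all annuli
this is a multiple of `M * lowerC φ r₀`, exactly and uniformly in the exponents. Since `(normConst n
φ)⁻¹` is at most a dimensional multiple of `lowerC φ 1 + upperC φ 1`, this contradicts the integral
inequality when `M` is a large multiple of `scaleFactor * f x`. Hence some annulus is good
(`exists_good_ring`).

In a good annulus concavity does the rest. Each point near `x` is the midpoint of two annulus points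
where `u` is close to the plane, so `Γ` lies between the plane and the plane minus `M s²` in a ball
around `x` (`plane_sub_le_concaveEnvelope`). Its slopes there differ from that of the plane by at
most a multiple of `M s`, which gives the gradient estimate; the good part of the annulus itself
gives the measure estimate (`isGoodCube_of_ring`).

The good scale depends on the point. The contact set is compact, so a stopping-time argument on
dyadic cubes selects a finite disjoint family (`exists_good_dyadic_cover`). -/

/-- The reference kernel `1 / (|y|ⁿ φ(|y|))`. -/
noncomputable def baseKernel (n : ℕ) (φ : ℝ → ℝ) (y : E n) : ℝ :=
  1 / (‖y‖ ^ n * φ ‖y‖)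

/-- The volume of the unit ball of `ℝⁿ`. -/
noncomputable def unitVol (n : ℕ) : ℝ := volume.real (Metric.ball (0 : E n) 1)

theorem unitVol_pos (n : ℕ) : 0 < unitVol n :=
  ENNReal.toReal_pos (Metric.measure_ball_pos volume 0 one_pos).ne' measure_ball_lt_top.ne

theorem nontrivial_E (n : ℕ) [NeZero n] : Nontrivial (E n) := by
  have : Nonempty (Fin n) := ⟨0⟩
  infer_instance

theorem volume_ball_eq {n : ℕ} (x : E n) {r : ℝ} (hr : 0 < r) :
    volume (Metric.ball x r) = ENNReal.ofReal (r ^ n * unitVol n) := by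
  rw [Measure.addHaar_ball_of_pos volume x hr, finrank_euclideanSpace_fin,
    ENNReal.ofReal_mul (by positivity), unitVol, measureReal_def,
    ENNReal.ofReal_toReal measure_ball_lt_top.ne]

theorem volume_closedBall_eq {n : ℕ} (x : E n) {r : ℝ} (hr : 0 ≤ r) :
    volume (Metric.closedBall x r) = ENNReal.ofReal (r ^ n * unitVol n) := by
  rw [Measure.addHaar_closedBall volume x hr, finrank_euclideanSpace_fin,
    ENNReal.ofReal_mul (by positivity), unitVol, measureReal_def,
    ENNReal.ofReal_toReal measure_ball_lt_top.ne]

/-! ### Weak scaling, polar coordinates and the normalizing constant. -/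

namespace WeakScaling

variable {φ : ℝ → ℝ} {a σ₁ σ₂ : ℝ}

theorem measurable_indicator (h : WeakScaling φ a σ₁ σ₂) :
    Measurable ((Ioi (0 : ℝ)).indicator φ) := by
  refine measurable_of_restrict_of_restrict_compl (s := Ioi (0 : ℝ)) measurableSet_Ioi ?_ ?_
  · convert h.measurable using 1
    ext x
    simp [Set.domRestrict]
  · convert measurable_const (a := (0 : ℝ)) using 1
    ext x
    have : (x : ℝ) ∉ Ioi (0 : ℝ) := x.2
    simp [Set.domRestrict, indicator_of_notMem this]

theorem aemeasurable_restrict (h : WeakScaling φ a σ₁ σ₂) {s : Set ℝ} (hs : s ⊆ Ioi 0) :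
    AEMeasurable φ (volume.restrict s) :=
  (aemeasurable_restrict_of_measurable_subtype measurableSet_Ioi h.measurable).mono_set hs

theorem baseKernel_measurable (h : WeakScaling φ a σ₁ σ₂) (n : ℕ) [NeZero n] :
    Measurable (baseKernel n φ) := by
  have : baseKernel n φ = fun y : E n => 1 / (‖y‖ ^ n * (Ioi (0 : ℝ)).indicator φ ‖y‖) := by
    ext y
    by_cases hy : y = 0
    -- As `n ≠ 0`, both sides are `1 / 0 = 0` at the origin, whatever the value `φ 0`.
    · simp [baseKernel, hy, NeZero.ne n]
    · rw [baseKernel, indicator_of_mem (by simpa using hy)]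
  rw [this]
  exact ((measurable_norm.pow_const n).mul (h.measurable_indicator.comp measurable_norm)).const_div 1

theorem baseKernel_nonneg (h : WeakScaling φ a σ₁ σ₂) (n : ℕ) [NeZero n] (y : E n) :
    0 ≤ baseKernel n φ y := by
  by_cases hy : y = 0
  · simp [baseKernel, hy, NeZero.ne n]
  · have := h.pos ‖y‖ (by simpa using hy)
    unfold baseKernel; positivity

theorem baseKernel_pos (h : WeakScaling φ a σ₁ σ₂) {n : ℕ} {y : E n} (hy : y ≠ 0) :
    0 < baseKernel n φ y := by
  have := h.pos ‖y‖ (by simpa using hy)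
  have : 0 < ‖y‖ := by simpa using hy
  unfold baseKernel; positivity

/-- Upper scaling against the endpoint `T` bounds `r / φ r` by a multiple of `r ^ (1 - σ₂)`,
integrable at `0` because `σ₂ < 2`. -/
theorem integrableOn_lower (h : WeakScaling φ a σ₁ σ₂) (h2 : σ₂ < 2) {T : ℝ} (hT : 0 < T) :
    IntegrableOn (fun r => r / φ r) (Ioo 0 T) := by
  have hφT := h.pos T hT
  have hint : IntegrableOn (fun r : ℝ => a * T ^ σ₂ / φ T * r ^ (1 - σ₂)) (Ioo 0 T) :=
    ((intervalIntegral.integrableOn_Ioo_rpow_iff hT).2 (by linarith)).const_mul _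
  refine Integrable.mono' hint ?_ ?_
  · exact (aemeasurable_id.div (h.aemeasurable_restrict fun r hr => hr.1)).aestronglyMeasurable
  · refine (ae_restrict_mem measurableSet_Ioo).mono fun r hr => ?_
    have hr0 := hr.1
    have hφr := h.pos r hr0
    have hu := h.upper r T hr0 hr.2.le
    rw [Real.norm_of_nonneg (by positivity), Real.rpow_sub hr0, Real.rpow_one]
    rw [Real.div_rpow hT.le hr0.le, div_le_iff₀ hφr] at hu
    have hrs : 0 < r ^ σ₂ := Real.rpow_pos_of_pos hr0 _
    rw [div_le_iff₀ hφr]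
    calc r = r / φ T * φ T := by field_simp
      _ ≤ r / φ T * (a * (T ^ σ₂ / r ^ σ₂) * φ r) := by gcongr
      _ = _ := by field_simp

theorem integrableOn_upper (h : WeakScaling φ a σ₁ σ₂) (ha : 1 ≤ a) (h1 : 0 < σ₁) :
    IntegrableOn (fun r => 1 / (r * φ r)) (Ioi 1) := by
  have hφ1 := h.pos 1 one_pos
  have hint : IntegrableOn (fun r : ℝ => a / φ 1 * r ^ (-1 - σ₁)) (Ioi 1) :=
    (integrableOn_Ioi_rpow_of_lt (by linarith) one_pos).const_mul _
  refine Integrable.mono' hint ?_ ?_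
  · exact ((aemeasurable_id.mul (h.aemeasurable_restrict
      fun r hr => lt_trans one_pos (mem_Ioi.1 hr))).const_div 1).aestronglyMeasurable
  · refine (ae_restrict_mem measurableSet_Ioi).mono fun r hr => ?_
    have hr1 : 1 < r := hr
    have hr0 : 0 < r := by linarith
    have hφr := h.pos r hr0
    have hl := h.lower 1 r one_pos hr1.le
    rw [Real.norm_of_nonneg (by positivity), Real.rpow_sub hr0, Real.rpow_neg_one]
    have hrs : 0 < r ^ σ₁ := Real.rpow_pos_of_pos hr0 _
    rw [div_one, le_div_iff₀ hφ1] at hl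
    have ha0 : 0 < a := by linarith
    rw [div_le_iff₀ (by positivity)]
    calc (1 : ℝ) = a / φ 1 * (r⁻¹ / r ^ σ₁) * (r * (a⁻¹ * r ^ σ₁ * φ 1)) := by field_simp
      _ ≤ _ := by gcongr

theorem radial_eq (n : ℕ) [NeZero n] {r : ℝ} (hr : 0 < r) :
    r ^ (n - 1) • (min (r ^ 2) 1 * (1 / (r ^ n * φ r))) = min (r ^ 2) 1 / (r * φ r) := by
  have : r ^ n = r ^ (n - 1) * r := by
    rw [← pow_succ, Nat.sub_add_cancel (NeZero.one_le)]
  rw [this, smul_eq_mul]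
  by_cases hφ : φ r = 0
  · simp [hφ]
  · field_simp

theorem eqOn_Ioc (n : ℕ) [NeZero n] :
    EqOn (fun r : ℝ => r ^ (n - 1) • (min (r ^ 2) 1 * (1 / (r ^ n * φ r)))) (fun r => r / φ r)
      (Ioc 0 1) := fun r hr => by
  have hr0 := hr.1
  have : min (r ^ 2) 1 = r ^ 2 := min_eq_left (by nlinarith [hr.2])
  change r ^ (n - 1) • _ = _
  rw [radial_eq n hr0, this]
  by_cases hφ : φ r = 0
  · simp [hφ]
  · field_simp

theorem eqOn_Ioi (n : ℕ) [NeZero n] :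
    EqOn (fun r : ℝ => r ^ (n - 1) • (min (r ^ 2) 1 * (1 / (r ^ n * φ r))))
      (fun r => 1 / (r * φ r)) (Ioi 1) := fun r hr => by
  have hr1 : 1 < r := hr
  have : min (r ^ 2) 1 = 1 := min_eq_right (by nlinarith)
  change r ^ (n - 1) • _ = _
  rw [radial_eq n (by linarith), this]

theorem integrable_min_mul_baseKernel (h : WeakScaling φ a σ₁ σ₂) (ha : 1 ≤ a) (h1 : 0 < σ₁)
    (h2 : σ₂ < 2) (n : ℕ) [NeZero n] :
    Integrable (fun y : E n => min (‖y‖ ^ 2) 1 * baseKernel n φ y) := by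
  have := nontrivial_E n
  refine (integrable_fun_norm_addHaar (volume : Measure (E n))
    (f := fun r => min (r ^ 2) 1 * (1 / (r ^ n * φ r)))).2 ?_
  rw [finrank_euclideanSpace_fin, ← Ioc_union_Ioi_eq_Ioi zero_le_one]
  refine IntegrableOn.union ?_ ?_
  · rw [integrableOn_congr_fun (eqOn_Ioc n) measurableSet_Ioc, integrableOn_Ioc_iff_integrableOn_Ioo]
    exact h.integrableOn_lower h2 one_pos
  · rw [integrableOn_congr_fun (eqOn_Ioi n) measurableSet_Ioi]
    exact h.integrableOn_upper ha h1

/-- Polar coordinates, split at radius `1`: the factor `min (r ^ 2) 1` leaves `r / φ r` inside and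
`1 / (r * φ r)` outside. This is how the sum of the two constants enters the theorem. -/
theorem integral_min_mul_baseKernel (h : WeakScaling φ a σ₁ σ₂) (ha : 1 ≤ a) (h1 : 0 < σ₁)
    (h2 : σ₂ < 2) (n : ℕ) [NeZero n] :
    ∫ y : E n, min (‖y‖ ^ 2) 1 * baseKernel n φ y =
      n * unitVol n * (lowerC φ 1 + upperC φ 1) := by
  have := nontrivial_E n
  have key := integral_fun_norm_addHaar (volume : Measure (E n))
    (fun r => min (r ^ 2) 1 * (1 / (r ^ n * φ r)))
  rw [finrank_euclideanSpace_fin, ← Ioc_union_Ioi_eq_Ioi zero_le_one, setIntegral_union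
    (by simp) measurableSet_Ioi, setIntegral_congr_fun measurableSet_Ioc (eqOn_Ioc n),
    setIntegral_congr_fun measurableSet_Ioi (eqOn_Ioi n), integral_Ioc_eq_integral_Ioo] at key
  · rw [nsmul_eq_mul, smul_eq_mul, ← mul_assoc] at key
    exact key
  · rw [integrableOn_congr_fun (eqOn_Ioc n) measurableSet_Ioc, integrableOn_Ioc_iff_integrableOn_Ioo]
    exact h.integrableOn_lower h2 one_pos
  · rw [integrableOn_congr_fun (eqOn_Ioi n) measurableSet_Ioi]
    exact h.integrableOn_upper ha h1

theorem lowerC_pos (h : WeakScaling φ a σ₁ σ₂) (h2 : σ₂ < 2) {T : ℝ} (hT : 0 < T) :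
    0 < lowerC φ T := by
  rw [lowerC, setIntegral_pos_iff_support_of_nonneg_ae]
  · refine lt_of_lt_of_le ?_ (measure_mono (show Ioo 0 T ⊆ _ from ?_))
    · simpa using hT
    · intro r hr
      exact ⟨(div_pos hr.1 (h.pos r hr.1)).ne', hr⟩
  · exact (ae_restrict_mem measurableSet_Ioo).mono fun r hr => (div_pos hr.1 (h.pos r hr.1)).le
  · exact h.integrableOn_lower h2 hT

theorem upperC_nonneg (h : WeakScaling φ a σ₁ σ₂) : 0 ≤ upperC φ 1 := by
  refine setIntegral_nonneg measurableSet_Ioi fun r hr => ?_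
  have hr0 : 0 < r := lt_trans one_pos (mem_Ioi.1 hr)
  have := h.pos r hr0
  positivity

theorem one_sub_cos_le (t : ℝ) : 1 - Real.cos t ≤ 2 * min (t ^ 2) 1 := by
  rcases min_choice (t ^ 2) 1 with h | h <;> rw [h]
  · have := @Real.one_sub_sq_div_two_le_cos t
    nlinarith [sq_nonneg t]
  · linarith [Real.neg_one_le_cos t]

theorem normConst_integrand_le (h : WeakScaling φ a σ₁ σ₂) (n : ℕ) [NeZero n] (y : E n) :
    (1 - Real.cos (y 0)) / (‖y‖ ^ n * φ ‖y‖) ≤ 2 * (min (‖y‖ ^ 2) 1 * baseKernel n φ y) := by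
  have hk := h.baseKernel_nonneg n y
  have h0 : (y 0) ^ 2 ≤ ‖y‖ ^ 2 := by
    rw [← sq_abs]
    have := PiLp.norm_apply_le y 0
    rw [Real.norm_eq_abs] at this
    gcongr
  have : min ((y 0) ^ 2) 1 ≤ min (‖y‖ ^ 2) 1 := min_le_min_right _ h0
  have h3 := one_sub_cos_le (y 0)
  calc (1 - Real.cos (y 0)) / (‖y‖ ^ n * φ ‖y‖) = (1 - Real.cos (y 0)) * baseKernel n φ y := by
        rw [baseKernel]; ring
    _ ≤ (2 * min (‖y‖ ^ 2) 1) * baseKernel n φ y := by gcongr; linarith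
    _ = _ := by ring

theorem normConst_integrand_nonneg (h : WeakScaling φ a σ₁ σ₂) (n : ℕ) [NeZero n] (y : E n) :
    0 ≤ (1 - Real.cos (y 0)) / (‖y‖ ^ n * φ ‖y‖) := by
  have hk := h.baseKernel_nonneg n y
  have : (1 - Real.cos (y 0)) / (‖y‖ ^ n * φ ‖y‖) = (1 - Real.cos (y 0)) * baseKernel n φ y := by
    rw [baseKernel]; ring
  rw [this]
  exact mul_nonneg (by linarith [Real.cos_le_one (y 0)]) hk

theorem integrable_normConst (h : WeakScaling φ a σ₁ σ₂) (ha : 1 ≤ a) (h1 : 0 < σ₁)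
    (h2 : σ₂ < 2) (n : ℕ) [NeZero n] :
    Integrable (fun y : E n => (1 - Real.cos (y 0)) / (‖y‖ ^ n * φ ‖y‖)) := by
  refine ((h.integrable_min_mul_baseKernel ha h1 h2 n).const_mul 2).mono' ?_ ?_
  · have : (fun y : E n => (1 - Real.cos (y 0)) / (‖y‖ ^ n * φ ‖y‖)) =
        fun y => (1 - Real.cos (y 0)) * baseKernel n φ y := by
      ext y; rw [baseKernel]; ring
    rw [this]
    refine (Measurable.mul ?_ (h.baseKernel_measurable n)).aestronglyMeasurable
    exact (by fun_prop : Continuous fun y : E n => 1 - Real.cos (y 0)).measurable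
  · exact .of_forall fun y => by
      rw [Real.norm_of_nonneg (h.normConst_integrand_nonneg n y)]
      exact h.normConst_integrand_le n y

theorem normConst_pos (h : WeakScaling φ a σ₁ σ₂) (ha : 1 ≤ a) (h1 : 0 < σ₁)
    (h2 : σ₂ < 2) (n : ℕ) [NeZero n] : 0 < normConst n φ := by
  rw [normConst, inv_pos, integral_pos_iff_support_of_nonneg
    (fun y => h.normConst_integrand_nonneg n y) (h.integrable_normConst ha h1 h2 n)]
  have ho : IsOpen {y : E n | Real.cos (y 0) < 1} :=
    isOpen_lt (by fun_prop) continuous_const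
  -- The integrand is nonzero on the open set where `cos y₁ < 1`, which contains the point `π e₁`.
  refine lt_of_lt_of_le (ho.measure_pos volume ⟨EuclideanSpace.single 0 Real.pi, ?_⟩)
    (measure_mono ?_)
  · simp
  · intro y hy
    have hy1 : Real.cos (y 0) < 1 := hy
    have hy0 : y ≠ 0 := by
      rintro rfl
      simp at hy1
    have hn : 0 < ‖y‖ := by simpa using hy0
    have := h.pos _ hn
    exact (div_pos (by linarith) (by positivity)).ne'

/-- Follows from `1 - cos y₁ ≤ 2 min(|y|², 1)`. It keeps the normalization from degenerating in
`exists_good_ring`. -/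
theorem inv_normConst_le (h : WeakScaling φ a σ₁ σ₂) (ha : 1 ≤ a) (h1 : 0 < σ₁)
    (h2 : σ₂ < 2) (n : ℕ) [NeZero n] :
    (normConst n φ)⁻¹ ≤ 2 * (n * unitVol n * (lowerC φ 1 + upperC φ 1)) := by
  rw [normConst, inv_inv, ← h.integral_min_mul_baseKernel ha h1 h2 n, ← integral_const_mul]
  exact integral_mono (h.integrable_normConst ha h1 h2 n)
    ((h.integrable_min_mul_baseKernel ha h1 h2 n).const_mul 2) (h.normConst_integrand_le n)

end WeakScaling

/-! ### The concave envelope and compactness of the contact set. -/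

section Envelope

variable {n : ℕ} {u : E n → ℝ} {R : ℝ}

theorem concaveEnvelope_le {p : E n} {c : ℝ}
    (h : ∀ y ∈ Metric.ball (0 : E n) (3 * R), max (u y) 0 ≤ inner ℝ p y + c) {x : E n}
    (hx : x ∈ Metric.ball (0 : E n) (3 * R)) : concaveEnvelope u R x ≤ inner ℝ p x + c := by
  rw [concaveEnvelope, if_pos hx]
  refine csInf_le ⟨0, ?_⟩ ⟨p, c, h, rfl⟩
  rintro t ⟨q, d, hq, rfl⟩
  exact (le_max_right _ _).trans (hq x hx)

/-- The infimum defining the concave envelope of a bounded function is attained. -/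
theorem exists_supporting_plane {B : ℝ} (hB : ∀ x, |u x| ≤ B) {x : E n}
    (hx : x ∈ Metric.ball (0 : E n) (3 * R)) :
    ∃ p : E n, ∀ y ∈ Metric.ball (0 : E n) (3 * R),
      max (u y) 0 ≤ concaveEnvelope u R x + inner ℝ p (y - x) := by
  have hB0 : 0 ≤ B := (abs_nonneg _).trans (hB 0)
  obtain ⟨δ, hδ, hball⟩ := Metric.nhds_basis_closedBall.mem_iff.1 (Metric.isOpen_ball.mem_nhds hx)
  set U := Metric.ball (0 : E n) (3 * R)
  -- Planes are recorded as (slope, value at `x`). Capping the value at `B` loses nothing, since the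
  -- constant plane `B` competes. Nonnegativity on a ball of radius `δ` around `x` then bounds the
  -- slope by `B / δ`, so the minimum is over a compact set.
  let S : Set (E n × ℝ) := (⋂ y ∈ U, {q | max (u y) 0 ≤ q.2 + inner ℝ q.1 (y - x)}) ∩ {q | q.2 ≤ B}
  have hmem : ∀ q : E n × ℝ, q ∈ S ↔
      (∀ y ∈ U, max (u y) 0 ≤ q.2 + inner ℝ q.1 (y - x)) ∧ q.2 ≤ B := by
    intro q; simp [S]
  have hclosed : IsClosed S := by
    refine (isClosed_biInter fun y _ => ?_).inter (isClosed_le continuous_snd continuous_const)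
    exact isClosed_le continuous_const
      (continuous_snd.add (continuous_fst.inner continuous_const))
  have hsub : S ⊆ Metric.closedBall (0 : E n) (B / δ) ×ˢ Icc 0 B := by
    intro q hq
    obtain ⟨hq1, hq2⟩ := (hmem q).1 hq
    have h0 : 0 ≤ q.2 := by
      have := hq1 x hx
      simp only [sub_self, inner_zero_right, add_zero] at this
      exact (le_max_right _ _).trans this
    refine ⟨?_, h0, hq2⟩
    rw [mem_closedBall_zero_iff, le_div_iff₀ hδ]
    by_cases hp : q.1 = 0
    · simpa [hp] using hB0
    have hpn : 0 < ‖q.1‖ := by simpa using hp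
    have := hq1 (x - (δ / ‖q.1‖) • q.1) (hball (by
      rw [Metric.mem_closedBall, dist_eq_norm, sub_sub_cancel_left, norm_neg, norm_smul,
        Real.norm_of_nonneg (by positivity), div_mul_cancel₀ _ hpn.ne']))
    have h3 := (le_max_right _ _).trans this
    rw [sub_sub_cancel_left, inner_neg_right, inner_smul_right, real_inner_self_eq_norm_sq] at h3
    have : δ / ‖q.1‖ * ‖q.1‖ ^ 2 = ‖q.1‖ * δ := by field_simp
    linarith
  have hne : S.Nonempty := ⟨(0, B), (hmem _).2 ⟨fun y _ => by
    simpa using ⟨(le_abs_self _).trans (hB y), hB0⟩, le_rfl⟩⟩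
  have hcomp : IsCompact S :=
    ((isCompact_closedBall _ _).prod isCompact_Icc).of_isClosed_subset hclosed hsub
  obtain ⟨⟨p, t⟩, hq, hmin⟩ := hcomp.exists_isMinOn hne continuous_snd.continuousOn
  obtain ⟨hq1, hq2⟩ := (hmem _).1 hq
  have hle : t ≤ concaveEnvelope u R x := by
    rw [concaveEnvelope, if_pos hx]
    refine le_csInf ⟨_, p, t - inner ℝ p x, fun y hy => ?_, rfl⟩ ?_
    · have := hq1 y hy
      rw [inner_sub_right] at this
      linarith
    · rintro s ⟨p', c', h', rfl⟩
      by_cases hs : inner ℝ p' x + c' ≤ B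
      · refine hmin (a := (p', inner ℝ p' x + c')) ((hmem _).2 ⟨fun y hy => ?_, hs⟩)
        have := h' y hy
        rw [inner_sub_right]
        linarith
      · exact hq2.trans (not_le.1 hs).le
  exact ⟨p, fun y hy => (hq1 y hy).trans (by simpa using hle)⟩

theorem max_le_concaveEnvelope {B : ℝ} (hB : ∀ x, |u x| ≤ B) {x : E n}
    (hx : x ∈ Metric.ball (0 : E n) (3 * R)) : max (u x) 0 ≤ concaveEnvelope u R x := by
  obtain ⟨p, hp⟩ := exists_supporting_plane hB hx
  simpa using hp x hx

theorem concaveEnvelope_le_of_plane {p x : E n} {t : ℝ}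
    (h : ∀ y ∈ Metric.ball (0 : E n) (3 * R), max (u y) 0 ≤ t + inner ℝ p (y - x)) {y : E n}
    (hy : y ∈ Metric.ball (0 : E n) (3 * R)) : concaveEnvelope u R y ≤ t + inner ℝ p (y - x) := by
  have := concaveEnvelope_le (p := p) (c := t - inner ℝ p x) (fun z hz => by
    have := h z hz
    rw [inner_sub_right] at this
    linarith) hy
  rw [inner_sub_right]
  linarith

theorem concaveOn_concaveEnvelope {B : ℝ} (hB : ∀ x, |u x| ≤ B) :
    ConcaveOn ℝ (Metric.ball (0 : E n) (3 * R)) (concaveEnvelope u R) := by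
  refine ⟨convex_ball _ _, fun y hy z hz α β hα hβ hαβ => ?_⟩
  have hw := convex_ball (0 : E n) (3 * R) hy hz hα hβ hαβ
  obtain ⟨p, hp⟩ := exists_supporting_plane hB hw
  have h1 := concaveEnvelope_le_of_plane hp hy
  have h2 := concaveEnvelope_le_of_plane hp hz
  have h3 : α * inner ℝ p (y - (α • y + β • z)) + β * inner ℝ p (z - (α • y + β • z)) = 0 := by
    simp only [inner_sub_right, inner_add_right, inner_smul_right]
    have : β = 1 - α := by linarith
    subst this; ring
  simp only [smul_eq_mul]
  set G := concaveEnvelope u R (α • y + β • z)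
  calc α * concaveEnvelope u R y + β * concaveEnvelope u R z
      ≤ α * (G + inner ℝ p (y - (α • y + β • z))) + β * (G + inner ℝ p (z - (α • y + β • z))) := by
        gcongr
    _ = (α + β) * G + (α * inner ℝ p (y - (α • y + β • z))
          + β * inner ℝ p (z - (α • y + β • z))) := by ring
    _ = G := by rw [h3, hαβ]; ring

/-- A supporting plane at `z` is at least `u x₁` at `x₁` and nonnegative at `z - (x₁ - z) / 2`,
which is still in `B_{3R}`; eliminating the slope gives the factor `1 / 3`. Consequently `Γ`, and so
`u` on the contact set, is strictly positive once `u` is positive somewhere. -/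
theorem concaveEnvelope_ge {B : ℝ} (hB : ∀ x, |u x| ≤ B) (hR : 0 < R) {x₁ z : E n}
    (hx₁ : ‖x₁‖ ≤ R) (hz : ‖z‖ ≤ R) : u x₁ / 3 ≤ concaveEnvelope u R z := by
  have hz3 : z ∈ Metric.ball (0 : E n) (3 * R) := by
    rw [mem_ball_zero_iff]; linarith
  obtain ⟨p, hp⟩ := exists_supporting_plane hB hz3
  have h1 := (le_max_left _ _).trans (hp x₁ (by rw [mem_ball_zero_iff]; linarith))
  have h2 := (le_max_right _ _).trans (hp (z - (1 / 2 : ℝ) • (x₁ - z)) (by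
    rw [mem_ball_zero_iff]
    calc ‖z - (1 / 2 : ℝ) • (x₁ - z)‖ ≤ ‖z‖ + ‖(1 / 2 : ℝ) • (x₁ - z)‖ := norm_sub_le _ _
      _ ≤ ‖z‖ + 1 / 2 * (‖x₁‖ + ‖z‖) := by
        rw [norm_smul, Real.norm_of_nonneg (by norm_num)]
        gcongr
        exact norm_sub_le _ _
      _ < 3 * R := by linarith))
  rw [sub_sub_cancel_left, inner_neg_right, inner_smul_right] at h2
  linarith

/-- `u - Γ` is upper semicontinuous on the closed ball, so `{u - Γ ≥ 0}` is compact there. No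
boundary point belongs to it, because there `u ≤ 0 < Γ`. -/
theorem isCompact_contactSet {B : ℝ} (hB : ∀ x, |u x| ≤ B) (hR : 0 < R)
    (husc : UpperSemicontinuousOn u (closure (Metric.ball (0 : E n) R)))
    (hout : ∀ x, x ∉ Metric.ball (0 : E n) R → u x ≤ 0) (hpos : ∃ x, 0 < u x) :
    IsCompact (contactSet u R) := by
  obtain ⟨x₁, hx₁⟩ := hpos
  have hx₁R : ‖x₁‖ ≤ R := by
    by_contra h
    exact absurd (hout x₁ (by rw [mem_ball_zero_iff]; intro h'; exact h h'.le)) (not_le.2 hx₁)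
  rw [closure_ball _ hR.ne'] at husc
  have hsub : Metric.closedBall (0 : E n) R ⊆ Metric.ball 0 (3 * R) :=
    Metric.closedBall_subset_ball (by linarith)
  have hcont : ContinuousOn (fun x => -concaveEnvelope u R x) (Metric.closedBall (0 : E n) R) :=
    (((concaveOn_concaveEnvelope hB).continuousOn Metric.isOpen_ball).mono hsub).neg
  have hd : UpperSemicontinuousOn (fun x => u x + -concaveEnvelope u R x)
      (Metric.closedBall (0 : E n) R) := husc.add hcont.upperSemicontinuousOn
  have hc := hd.isCompact_inter_preimage_Ici (isCompact_closedBall _ _) 0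
  convert hc using 1
  ext x
  simp only [contactSet, mem_ofPred_eq, mem_inter_iff, mem_preimage, mem_Ici]
  constructor
  · rintro ⟨h1, h2⟩
    exact ⟨Metric.ball_subset_closedBall h1, by linarith⟩
  · rintro ⟨h1, h2⟩
    have h3 := concaveEnvelope_ge hB hR hx₁R (mem_closedBall_zero_iff.1 h1)
    refine ⟨?_, le_antisymm ((le_max_left _ _).trans (max_le_concaveEnvelope hB (hsub h1)))
      (by linarith)⟩
    by_contra h4
    have := hout x h4
    linarith

end Envelope

/-! ### From the viscosity inequality to an integral inequality at contact points. -/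

section Viscosity

variable {n : ℕ} {u : E n → ℝ} {R : ℝ}

theorem aemeasurable_secondDiff (hu : AEMeasurable u volume) (x : E n) :
    AEMeasurable (secondDiff u x) volume := by
  have h1 : AEMeasurable (fun y => u (x + y)) volume :=
    hu.comp_quasiMeasurePreserving (measurePreserving_add_left volume x).quasiMeasurePreserving
  have h2 : AEMeasurable (fun y => u (x - y)) volume :=
    hu.comp_quasiMeasurePreserving
      (Measure.measurePreserving_sub_left volume x).quasiMeasurePreserving
  exact (h1.add h2).sub_const _

theorem abs_secondDiff_le {B : ℝ} (hB : ∀ x, |u x| ≤ B) (x y : E n) :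
    |secondDiff u x y| ≤ 4 * B := by
  have h1 := abs_le.1 (hB (x + y))
  have h2 := abs_le.1 (hB (x - y))
  have h3 := abs_le.1 (hB x)
  rw [secondDiff, abs_le]
  constructor <;> linarith

/-- Second differences are nonpositive at a point where a plane touches from above in `B_{3R}`. -/
theorem secondDiff_nonpos (hout : ∀ x, x ∉ Metric.ball (0 : E n) R → u x ≤ 0)
    {x p : E n} (hx : x ∈ Metric.ball (0 : E n) R) (hux : 0 ≤ u x)
    (hp : ∀ y ∈ Metric.ball (0 : E n) (3 * R), u y ≤ u x + inner ℝ p (y - x)) (y : E n) :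
    secondDiff u x y ≤ 0 := by
  rw [mem_ball_zero_iff] at hx
  rw [secondDiff]
  by_cases h : x + y ∈ Metric.ball (0 : E n) (3 * R) ∧ x - y ∈ Metric.ball (0 : E n) (3 * R)
  · have h1 := hp _ h.1
    have h2 := hp _ h.2
    rw [add_sub_cancel_left] at h1
    rw [sub_sub_cancel_left, inner_neg_right] at h2
    linarith
  -- If one of `x ± y` leaves `B_{3R}`, then `|y| ≥ 2R` puts both of them outside `B_R`, where `u ≤
  -- 0 ≤ u x`.
  · have hy : 2 * R ≤ ‖y‖ := by
      simp only [mem_ball_zero_iff, not_and_or, not_lt] at h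
      rcases h with h | h
      · linarith [norm_add_le x y]
      · linarith [norm_sub_le x y]
    have h1 := hout (x + y) (by
      rw [mem_ball_zero_iff, not_lt]
      have := norm_sub_le (x + y) x
      rw [add_sub_cancel_left] at this
      linarith)
    have h2 := hout (x - y) (by
      rw [mem_ball_zero_iff, not_lt]
      have := norm_sub_le x (x - y)
      rw [sub_sub_cancel] at this
      linarith)
    linarith

variable [NeZero n] {φ : ℝ → ℝ} {a σ₁ σ₂ : ℝ}

/-- Makes the kernel class nonempty, so that the supremum in `maxOp` is not the default value of
`sSup ∅`. -/
theorem isKernel_baseKernel (h : WeakScaling φ a σ₁ σ₂) (ha : 1 ≤ a) (h1 : 0 < σ₁) (h2 : σ₂ < 2)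
    {lam Lam : ℝ} (hl : lam ≤ Lam) :
    IsKernel φ lam Lam (fun y : E n => normConst n φ * (lam / (‖y‖ ^ n * φ ‖y‖))) := by
  have hC := h.normConst_pos ha h1 h2 n
  have heq : (fun y : E n => normConst n φ * (lam / (‖y‖ ^ n * φ ‖y‖))) =
      fun y => normConst n φ * lam * baseKernel n φ y := by
    ext y; rw [baseKernel]; ring
  refine ⟨?_, fun y => by simp, ?_, fun y _ => le_rfl, fun y hy => ?_⟩
  · rw [heq]
    exact (h.baseKernel_measurable n).const_mul _
  · have hm := h.baseKernel_measurable n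
    refine ((h.integrable_min_mul_baseKernel ha h1 h2 n).const_mul (normConst n φ * lam)).mono
      ?_ (.of_forall fun y => ?_)
    · rw [show (fun y : E n => ‖y‖ ^ 2 / (1 + ‖y‖ ^ 2) * (normConst n φ * (lam / (‖y‖ ^ n * φ ‖y‖))))
        = fun y => ‖y‖ ^ 2 / (1 + ‖y‖ ^ 2) * (normConst n φ * lam * baseKernel n φ y) from by
          ext y; rw [baseKernel]; ring]
      exact (by fun_prop : Measurable fun y : E n =>
        ‖y‖ ^ 2 / (1 + ‖y‖ ^ 2) * (normConst n φ * lam * baseKernel n φ y)).aestronglyMeasurable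
    · have e : normConst n φ * (lam / (‖y‖ ^ n * φ ‖y‖)) = normConst n φ * lam * baseKernel n φ y :=
        congrFun heq y
      rw [e, mul_left_comm (normConst n φ * lam) (min _ _), norm_mul (‖y‖ ^ 2 / _),
        norm_mul (min _ _)]
      refine mul_le_mul_of_nonneg_right ?_ (norm_nonneg _)
      rw [Real.norm_of_nonneg (by positivity), Real.norm_of_nonneg (by positivity)]
      refine le_min (div_le_self (by positivity) (by nlinarith [sq_nonneg ‖y‖])) ?_
      rw [div_le_one (by positivity)]
      linarith
  · have := h.pos ‖y‖ (by simpa using hy)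
    gcongr

theorem integrableOn_secondDiff (h : WeakScaling φ a σ₁ σ₂) (ha : 1 ≤ a) (h1 : 0 < σ₁)
    (h2 : σ₂ < 2) (hu : AEMeasurable u volume) {B : ℝ} (hB : ∀ x, |u x| ≤ B) (x : E n)
    {ρ : ℝ} (hρ : 0 < ρ) :
    IntegrableOn (fun y => secondDiff u x y * baseKernel n φ y) {y | ρ ≤ ‖y‖} := by
  have hS : MeasurableSet {y : E n | ρ ≤ ‖y‖} := measurableSet_le measurable_const measurable_norm
  have hB0 : 0 ≤ B := (abs_nonneg _).trans (hB 0)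
  refine Integrable.mono' ((h.integrable_min_mul_baseKernel ha h1 h2 n).const_mul
    (4 * B / min (ρ ^ 2) 1)).integrableOn ?_ ?_
  · exact ((aemeasurable_secondDiff hu x).mul
      (h.baseKernel_measurable n).aemeasurable).aestronglyMeasurable.restrict
  · refine (ae_restrict_mem hS).mono fun y hy => ?_
    have hy' : ρ ≤ ‖y‖ := hy
    have hk := h.baseKernel_nonneg n y
    rw [norm_mul, Real.norm_of_nonneg hk, ← mul_assoc, Real.norm_eq_abs]
    refine mul_le_mul_of_nonneg_right ((abs_secondDiff_le hB x y).trans ?_) hk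
    have hm : 0 < min (ρ ^ 2) 1 := lt_min (by positivity) one_pos
    rw [div_mul_eq_mul_div, le_div_iff₀ hm]
    gcongr

open Classical in
/-- At a point touched from above by a plane the equation holds in the classical sense, away from
the singularity of the kernel. -/
theorem viscosity_integral_le (h : WeakScaling φ a σ₁ σ₂) (ha : 1 ≤ a) (h1 : 0 < σ₁)
    (h2 : σ₂ < 2) {lam Lam : ℝ} (hlam : 0 < lam) (hl : lam ≤ Lam) (hR : 0 < R) {f : E n → ℝ}
    (hsub : IsViscositySubsolution (maxOp φ lam Lam) (fun x => -f x) (Metric.ball 0 R) u)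
    (hout : ∀ x, x ∉ Metric.ball (0 : E n) R → u x ≤ 0)
    {x p : E n} (hx : x ∈ Metric.ball (0 : E n) R) (hux : 0 ≤ u x)
    (hp : ∀ y ∈ Metric.ball (0 : E n) (3 * R), u y ≤ u x + inner ℝ p (y - x))
    {ρ : ℝ} (hρ : 0 < ρ) (hball : Metric.ball x ρ ⊆ Metric.ball 0 R) :
    lam * normConst n φ * ∫ y in {y : E n | ρ ≤ ‖y‖}, -secondDiff u x y * baseKernel n φ y
      ≤ f x := by
  obtain ⟨B, hB⟩ := hsub.bounded
  have hC := h.normConst_pos ha h1 h2 n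
  have hB0 : 0 ≤ B := (abs_nonneg _).trans (hB 0)
  set S : Set (E n) := {y | ρ ≤ ‖y‖} with hSdef
  have hS : MeasurableSet S := measurableSet_le measurable_const measurable_norm
  have hδ := secondDiff_nonpos hout hx hux hp
  set Cn := normConst n φ
  set A : ℝ := ∫ y in Sᶜ, ‖y‖ ^ 2 * baseKernel n φ y
  set D : ℝ := ∫ y in S, secondDiff u x y * baseKernel n φ y with hD
  have hintA : IntegrableOn (fun y : E n => ‖y‖ ^ 2 * baseKernel n φ y) Sᶜ := by
    refine Integrable.mono' ((h.integrable_min_mul_baseKernel ha h1 h2 n).const_mul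
      (1 + ρ ^ 2)).integrableOn ?_ ?_
    · exact ((measurable_norm.pow_const 2).mul
        (h.baseKernel_measurable n)).aestronglyMeasurable
    · refine (ae_restrict_mem hS.compl).mono fun y hy => ?_
      have hy' : ‖y‖ < ρ := by simpa [S] using hy
      have hk := h.baseKernel_nonneg n y
      rw [norm_mul, Real.norm_of_nonneg hk, ← mul_assoc, Real.norm_of_nonneg (by positivity)]
      refine mul_le_mul_of_nonneg_right ?_ hk
      have h4 : ‖y‖ ^ 2 ≤ ρ ^ 2 := by gcongr
      rcases min_choice (‖y‖ ^ 2) 1 with h | h <;> rw [h]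
      · nlinarith [sq_nonneg ‖y‖, sq_nonneg ρ]
      · linarith
  have hintD := integrableOn_secondDiff h ha h1 h2 hsub.aemeasurable hB x hρ
  have hA0 : 0 ≤ A := setIntegral_nonneg hS.compl fun y _ =>
    mul_nonneg (by positivity) (h.baseKernel_nonneg n y)
  have main : ∀ ε : ℝ, 0 < ε → -f x ≤ ε * (2 * Lam * Cn * A) + lam * Cn * D := by
    intro ε hε
    -- The quadratic term makes the touching strict; it contributes `2ε|y|²` to the second
    -- difference inside the ball and nothing outside.
    set ψ : E n → ℝ := fun y => u x + inner ℝ p (y - x) + ε * ‖y - x‖ ^ 2 with hψ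
    set v : E n → ℝ := fun y => if y ∈ Metric.ball x ρ then ψ y else u y with hv
    have hψc : ContDiff ℝ 2 ψ := by
      have hs : ContDiff ℝ 2 fun y : E n => y - x := contDiff_id.sub contDiff_const
      exact (contDiff_const.add (contDiff_const.inner ℝ hs)).add
        (contDiff_const.mul (hs.norm_sq ℝ))
    have hψx : ψ x = u x := by simp [hψ]
    have htest := hsub.test x hx (Metric.ball x ρ) Metric.isOpen_ball (Metric.mem_ball_self hρ)
      Metric.isBounded_ball hball ψ hψc hψx (fun y hy => by
        have hy3 : y ∈ Metric.ball (0 : E n) (3 * R) :=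
          Metric.ball_subset_ball (by linarith) (hball hy.1)
        have hne : 0 < ‖y - x‖ := norm_pos_iff.2 (sub_ne_zero.2 hy.2)
        have : 0 < ε * ‖y - x‖ ^ 2 := by positivity
        have := hp y hy3
        simp only [hψ]
        linarith) v (fun y hy => by simp only [hv, if_pos hy]) (fun y hy => by
          simp only [hv, if_neg hy])
    refine htest.trans ?_
    have hvx : v x = u x := by simp only [hv, if_pos (Metric.mem_ball_self hρ), hψx]
    have hvS : ∀ y ∈ S, secondDiff v x y = secondDiff u x y := by
      intro y hy
      have hy' : ρ ≤ ‖y‖ := hy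
      have e1 : v (x + y) = u (x + y) := if_neg (by simpa [Metric.mem_ball, dist_eq_norm] using hy')
      have e2 : v (x - y) = u (x - y) := if_neg (by simpa [Metric.mem_ball, dist_eq_norm] using hy')
      rw [secondDiff, secondDiff, e1, e2, hvx]
    have hvN : ∀ y ∉ S, secondDiff v x y = 2 * ε * ‖y‖ ^ 2 := by
      intro y hy
      have hy' : ‖y‖ < ρ := by simpa [S] using hy
      have e1 : v (x + y) = ψ (x + y) := if_pos (by simpa [Metric.mem_ball, dist_eq_norm] using hy')
      have e2 : v (x - y) = ψ (x - y) := if_pos (by simpa [Metric.mem_ball, dist_eq_norm] using hy')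
      rw [secondDiff, e1, e2, hvx]
      simp only [hψ, add_sub_cancel_left, sub_sub_cancel_left, inner_neg_right, norm_neg]
      ring
    refine csSup_le ⟨_, _, isKernel_baseKernel h ha h1 h2 hl, rfl⟩ ?_
    rintro t ⟨K, hK, rfl⟩
    have hvm : AEMeasurable (secondDiff v x) volume := by
      have : AEMeasurable (fun y => S.indicator (secondDiff u x) y +
          Sᶜ.indicator (fun y => 2 * ε * ‖y‖ ^ 2) y) volume :=
        ((aemeasurable_secondDiff hsub.aemeasurable x).indicator hS).add
          (((measurable_norm.pow_const 2).const_mul (2 * ε)).aemeasurable.indicator hS.compl)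
      convert this using 1
      ext y
      by_cases hy : y ∈ S
      · rw [indicator_of_mem hy, indicator_of_notMem (by simpa using hy), hvS y hy, add_zero]
      · rw [indicator_of_notMem hy, indicator_of_mem hy, hvN y hy, zero_add]
    -- Domination by a multiple of `|y|² / (1 + |y|²)` makes `secondDiff v x y * K y` integrable by
    -- the defining condition on `K`.
    have hvbd : ∀ y, |secondDiff v x y| ≤
        (2 * ε * (1 + ρ ^ 2) + 4 * B * (1 + 1 / ρ ^ 2)) * (‖y‖ ^ 2 / (1 + ‖y‖ ^ 2)) := by
      intro y
      have ht : 0 ≤ ‖y‖ ^ 2 / (1 + ‖y‖ ^ 2) := by positivity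
      by_cases hy : y ∈ S
      · rw [hvS y hy]
        have hy' : ρ ≤ ‖y‖ := hy
        have : 1 ≤ (1 + 1 / ρ ^ 2) * (‖y‖ ^ 2 / (1 + ‖y‖ ^ 2)) := by
          have : ρ ^ 2 ≤ ‖y‖ ^ 2 := by gcongr
          rw [← mul_div_assoc, le_div_iff₀ (by positivity)]
          have : 1 ≤ 1 / ρ ^ 2 * ‖y‖ ^ 2 := by
            rw [div_mul_eq_mul_div, le_div_iff₀ (by positivity)]; linarith
          linarith
        calc |secondDiff u x y| ≤ 4 * B * 1 := by linarith [abs_secondDiff_le hB x y]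
          _ ≤ 4 * B * ((1 + 1 / ρ ^ 2) * (‖y‖ ^ 2 / (1 + ‖y‖ ^ 2))) := by gcongr
          _ ≤ _ := by
            have : 0 ≤ 2 * ε * (1 + ρ ^ 2) * (‖y‖ ^ 2 / (1 + ‖y‖ ^ 2)) := by positivity
            linarith
      · have hy' : ‖y‖ < ρ := by simpa [S] using hy
        rw [hvN y hy, abs_of_nonneg (by positivity)]
        have : ‖y‖ ^ 2 ≤ (1 + ρ ^ 2) * (‖y‖ ^ 2 / (1 + ‖y‖ ^ 2)) := by
          have : ‖y‖ ^ 2 ≤ ρ ^ 2 := by gcongr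
          rw [← mul_div_assoc, le_div_iff₀ (by positivity), mul_comm]
          gcongr
        calc 2 * ε * ‖y‖ ^ 2 ≤ 2 * ε * ((1 + ρ ^ 2) * (‖y‖ ^ 2 / (1 + ‖y‖ ^ 2))) := by gcongr
          _ ≤ _ := by
            have : 0 ≤ 4 * B * (1 + 1 / ρ ^ 2) * (‖y‖ ^ 2 / (1 + ‖y‖ ^ 2)) := by positivity
            linarith
    have hintv : Integrable (fun y => secondDiff v x y * K y) := by
      refine (hK.integrable.const_mul
        (2 * ε * (1 + ρ ^ 2) + 4 * B * (1 + 1 / ρ ^ 2))).mono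
        (hvm.mul hK.measurable.aemeasurable).aestronglyMeasurable (.of_forall fun y => ?_)
      rw [norm_mul, ← mul_assoc, norm_mul _ (K y)]
      refine mul_le_mul_of_nonneg_right ?_ (norm_nonneg _)
      exact (hvbd y).trans (le_abs_self _)
    have hi1 : Integrable (S.indicator fun y => lam * Cn * (secondDiff u x y * baseKernel n φ y)) :=
      (integrable_indicator_iff hS).2 (hintD.const_mul _)
    have hi2 : Integrable (Sᶜ.indicator fun y =>
        2 * ε * Lam * Cn * (‖y‖ ^ 2 * baseKernel n φ y)) :=
      (integrable_indicator_iff hS.compl).2 (hintA.const_mul _)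
    have hle : linOp K v x ≤ ∫ y, (S.indicator (fun y =>
          lam * Cn * (secondDiff u x y * baseKernel n φ y)) y +
        Sᶜ.indicator (fun y => 2 * ε * Lam * Cn * (‖y‖ ^ 2 * baseKernel n φ y)) y) := by
      refine integral_mono_ae hintv (hi1.add hi2) ?_
      have := nontrivial_E n
      have hne : ∀ᵐ y : E n, y ≠ 0 := by
        simp [ae_iff, measure_singleton]
      filter_upwards [hne] with y hy0
      have hKl := hK.lower y hy0
      have hKu := hK.upper y hy0
      have el : normConst n φ * (lam / (‖y‖ ^ n * φ ‖y‖)) = lam * Cn * baseKernel n φ y := by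
        rw [baseKernel]; ring
      have eu : normConst n φ * (Lam / (‖y‖ ^ n * φ ‖y‖)) = Lam * Cn * baseKernel n φ y := by
        rw [baseKernel]; ring
      rw [el] at hKl
      rw [eu] at hKu
      -- On `S` the second difference is nonpositive, so the lower kernel bound gives an upper bound
      -- for the product. Off `S` it is nonnegative and the upper kernel bound is used.
      by_cases hy : y ∈ S
      · rw [hvS y hy, indicator_of_mem hy, indicator_of_notMem (by simpa using hy), add_zero]
        nlinarith [hδ y]
      · rw [hvN y hy, indicator_of_notMem hy, indicator_of_mem hy, zero_add]
        calc 2 * ε * ‖y‖ ^ 2 * K y ≤ 2 * ε * ‖y‖ ^ 2 * (Lam * Cn * baseKernel n φ y) := by gcongr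
          _ = _ := by ring
    refine hle.trans (le_of_eq ?_)
    rw [integral_add hi1 hi2, integral_indicator hS, integral_indicator hS.compl,
      integral_const_mul, integral_const_mul]
    ring
  have hlim : -f x ≤ lam * Cn * D := by
    have hX : 0 ≤ 2 * Lam * Cn * A := by
      have : 0 < Lam := hlam.trans_le hl
      positivity
    refine le_of_forall_pos_le_add fun η hη => ?_
    -- The `+ 1` avoids dividing by zero, as only nonnegativity of `2 * Lam * Cn * A` is known.
    have := main (η / (2 * Lam * Cn * A + 1)) (by positivity)
    have h4 : η / (2 * Lam * Cn * A + 1) * (2 * Lam * Cn * A) ≤ η := by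
      rw [div_mul_eq_mul_div, div_le_iff₀ (by positivity)]
      nlinarith
    linarith
  have e : ∫ y in S, -secondDiff u x y * baseKernel n φ y = -D := by
    rw [hD, ← integral_neg]
    simp only [neg_mul]
  rw [e]
  linarith

end Viscosity

/-! ### Energy in dyadic annuli and the existence of a good annulus. -/

section Rings

variable {n : ℕ} {u : E n → ℝ} {R : ℝ} {φ : ℝ → ℝ} {a σ₁ σ₂ : ℝ}

/-- The annulus `s / 2 < |y| ≤ s`. -/
def ring (n : ℕ) (s : ℝ) : Set (E n) := {y | s / 2 < ‖y‖ ∧ ‖y‖ ≤ s}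

theorem WeakScaling.le_of_mem_Ioc (h : WeakScaling φ a σ₁ σ₂) (ha : 1 ≤ a) (h1 : 0 < σ₁)
    {r s : ℝ} (hr0 : 0 < r) (hrs : r ≤ s) : φ r ≤ a * φ s := by
  have hφr := h.pos r hr0
  have hl := h.lower r s hr0 hrs
  have h3 : 1 ≤ (s / r) ^ σ₁ := Real.one_le_rpow ((one_le_div hr0).2 hrs) h1.le
  have ha0 : 0 < a := by linarith
  have h4 : a⁻¹ ≤ φ s / φ r := (le_mul_of_one_le_right (by positivity) h3).trans hl
  rw [le_div_iff₀ hφr, inv_mul_le_iff₀ ha0] at h4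
  exact h4

/-- The factor `4` bounds `2 ^ σ₂` for every `σ₂ < 2`, which keeps the later constants free of the
exponents. -/
theorem WeakScaling.le_four_mul (h : WeakScaling φ a σ₁ σ₂) (ha : 1 ≤ a) (hσ : 0 < σ₂)
    (h2 : σ₂ < 2) {r s : ℝ} (hr0 : 0 < r) (hrs : r ≤ s) (hs : s ≤ 2 * r) :
    φ s ≤ 4 * a * φ r := by
  have hφr := h.pos r hr0
  have hu := h.upper r s hr0 hrs
  have h3 : (s / r) ^ σ₂ ≤ 4 := by
    calc (s / r) ^ σ₂ ≤ 2 ^ σ₂ :=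
          Real.rpow_le_rpow (div_nonneg (hr0.le.trans hrs) hr0.le) ((div_le_iff₀ hr0).2 hs) hσ.le
      _ ≤ 2 ^ (2 : ℝ) := Real.rpow_le_rpow_of_exponent_le (by norm_num) h2.le
      _ = 4 := by norm_num
  rw [div_le_iff₀ hφr] at hu
  calc φ s ≤ a * (s / r) ^ σ₂ * φ r := hu
    _ ≤ a * 4 * φ r := by gcongr
    _ = _ := by ring

theorem WeakScaling.integral_ring_le (h : WeakScaling φ a σ₁ σ₂) (ha : 1 ≤ a) (hσ : 0 < σ₂)
    (h2 : σ₂ < 2) {s : ℝ} (hs : 0 < s) :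
    ∫ r in Ioc (s / 2) s, r / φ r ≤ 2 * a * s ^ 2 / φ s := by
  have hφs := h.pos s hs
  have hsub : Ioc (s / 2) s ⊆ Ioc 0 s := Ioc_subset_Ioc_left (by positivity)
  have hint : IntegrableOn (fun r => r / φ r) (Ioc (s / 2) s) :=
    ((integrableOn_Ioc_iff_integrableOn_Ioo).2 (h.integrableOn_lower h2 hs)).mono_set hsub
  calc ∫ r in Ioc (s / 2) s, r / φ r ≤ ∫ _ in Ioc (s / 2) s, 4 * a * s / φ s := by
        refine setIntegral_mono_on hint (integrableOn_const (by simp)) measurableSet_Ioc ?_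
        intro r hr
        have hr0 : 0 < r := (hsub hr).1
        have hφr := h.pos r hr0
        have := h.le_four_mul ha hσ h2 hr0 hr.2 (by linarith [hr.1])
        rw [div_le_div_iff₀ hφr hφs]
        calc r * φ s ≤ s * (4 * a * φ r) := by gcongr; exact hr.2
          _ = _ := by ring
    _ = 2 * a * s ^ 2 / φ s := by
        simp only [integral_const, measureReal_restrict_apply_univ, Real.volume_real_Ioc, smul_eq_mul]
        rw [max_eq_left (by linarith)]
        ring

theorem measurableSet_ring (s : ℝ) : MeasurableSet (ring n s) :=
  (measurableSet_lt measurable_const measurable_norm).inter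
    (measurableSet_le measurable_norm measurable_const)

theorem baseKernel_ge_of_mem_ring (h : WeakScaling φ a σ₁ σ₂) (ha : 1 ≤ a) (h1 : 0 < σ₁)
    {s : ℝ} (hs : 0 < s) {y : E n} (hy : y ∈ ring n s) :
    1 / (s ^ n * (a * φ s)) ≤ baseKernel n φ y := by
  have hy0 : 0 < ‖y‖ := lt_trans (by positivity) hy.1
  have := h.pos _ hy0
  have := h.le_of_mem_Ioc ha h1 hy0 hy.2
  have := hy.2
  unfold baseKernel
  gcongr

/-- The lower bound for the energy of a function `g` which is at least `M s²` on a portion of the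
annulus of radius `s`. -/
theorem integral_ring_ge (h : WeakScaling φ a σ₁ σ₂) (ha : 1 ≤ a) (h1 : 0 < σ₁) (hσ : 0 < σ₂)
    (h2 : σ₂ < 2) {g : E n → ℝ} (hg : ∀ y, 0 ≤ g y) {s M β : ℝ} (hs : 0 < s) (hM : 0 ≤ M)
    (hβ : 0 < β) (hint : IntegrableOn (fun y => g y * baseKernel n φ y) (ring n s)) {b : Set (E n)}
    (hb : NullMeasurableSet b) (hbr : b ⊆ ring n s) (hbg : ∀ y ∈ b, M * s ^ 2 ≤ g y)
    (hvol : ENNReal.ofReal (β * s ^ n) ≤ volume b) :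
    M * β / (2 * a ^ 2) * ∫ r in Ioc (s / 2) s, r / φ r ≤
      ∫ y in ring n s, g y * baseKernel n φ y := by
  -- Since `u` is only a.e. measurable, `b` is replaced by a measurable subset of the same volume.
  obtain ⟨t, htb, htm, hte⟩ := hb.exists_measurable_subset_ae_eq
  have hφs := h.pos s hs
  have hfin : volume t ≠ ⊤ := by
    refine ne_top_of_le_ne_top (measure_closedBall_lt_top (x := (0 : E n)) (r := s)).ne
      (measure_mono fun y hy => ?_)
    rw [mem_closedBall_zero_iff]
    exact (hbr (htb hy)).2
  have hvt : β * s ^ n ≤ volume.real t := by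
    rw [measureReal_def, ← ENNReal.ofReal_le_iff_le_toReal hfin, measure_congr hte]
    exact hvol
  have hknn : ∀ y ∈ ring n s, 0 ≤ baseKernel n φ y := fun y hy =>
    le_trans (by positivity) (baseKernel_ge_of_mem_ring h ha h1 hs hy)
  have step : M * s ^ 2 * (1 / (s ^ n * (a * φ s))) * volume.real t ≤
      ∫ y in t, g y * baseKernel n φ y := by
    refine setIntegral_ge_of_const_le_real htm hfin (fun y hy => ?_)
      (hint.mono_set (htb.trans hbr))
    have := baseKernel_ge_of_mem_ring h ha h1 hs (hbr (htb hy))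
    have := hbg y (htb hy)
    have := hg y
    gcongr
  calc M * β / (2 * a ^ 2) * ∫ r in Ioc (s / 2) s, r / φ r
      ≤ M * β / (2 * a ^ 2) * (2 * a * s ^ 2 / φ s) := by
        gcongr
        exact h.integral_ring_le ha hσ h2 hs
    _ = M * s ^ 2 * (1 / (s ^ n * (a * φ s))) * (β * s ^ n) := by
        field_simp
    _ ≤ M * s ^ 2 * (1 / (s ^ n * (a * φ s))) * volume.real t := by gcongr
    _ ≤ ∫ y in t, g y * baseKernel n φ y := step
    _ ≤ _ := by
        refine setIntegral_mono_set hint ?_ (htb.trans hbr).eventuallyLE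
        exact (ae_restrict_mem (measurableSet_ring s)).mono fun y hy =>
          mul_nonneg (hg y) (hknn y hy)

theorem pow_radius_succ (T : ℝ) (m : ℕ) : T / 2 ^ (m + 1) = T / 2 ^ m / 2 := by
  rw [pow_succ]; field_simp

theorem integral_annulus_ge (h : WeakScaling φ a σ₁ σ₂) (ha : 1 ≤ a) (h1 : 0 < σ₁) (hσ : 0 < σ₂)
    (h2 : σ₂ < 2) {g : E n → ℝ} (hg : ∀ y, 0 ≤ g y) {T M β : ℝ} (hT : 0 < T) (hM : 0 ≤ M)
    (hβ : 0 < β)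
    (hint : ∀ ρ, 0 < ρ → IntegrableOn (fun y => g y * baseKernel n φ y) {y | ρ ≤ ‖y‖})
    {b : ℕ → Set (E n)} (hb : ∀ k, NullMeasurableSet (b k)) (hbr : ∀ k, b k ⊆ ring n (T / 2 ^ k))
    (hbg : ∀ k, ∀ y ∈ b k, M * (T / 2 ^ k) ^ 2 ≤ g y)
    (hvol : ∀ k, ENNReal.ofReal (β * (T / 2 ^ k) ^ n) ≤ volume (b k)) (m : ℕ) :
    M * β / (2 * a ^ 2) * ∫ r in Ioc (T / 2 ^ m) T, r / φ r ≤
      ∫ y in {y : E n | T / 2 ^ m < ‖y‖ ∧ ‖y‖ ≤ T}, g y * baseKernel n φ y := by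
  induction m with
  | zero =>
    have : {y : E n | T / 2 ^ 0 < ‖y‖ ∧ ‖y‖ ≤ T} = ∅ := by
      ext y; simp
    rw [this]
    simp
  | succ m ih =>
    have hs : 0 < T / 2 ^ m := by positivity
    have hsT : T / 2 ^ m ≤ T := div_le_self hT.le (one_le_pow₀ (by norm_num))
    have hunion : {y : E n | T / 2 ^ (m + 1) < ‖y‖ ∧ ‖y‖ ≤ T} =
        ring n (T / 2 ^ m) ∪ {y : E n | T / 2 ^ m < ‖y‖ ∧ ‖y‖ ≤ T} := by
      ext y
      simp only [ring, mem_union, mem_ofPred_eq, pow_radius_succ]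
      constructor
      · rintro ⟨h3, h4⟩
        rcases le_or_gt ‖y‖ (T / 2 ^ m) with h5 | h5
        · exact Or.inl ⟨h3, h5⟩
        · exact Or.inr ⟨h5, h4⟩
      · rintro (⟨h3, h4⟩ | ⟨h3, h4⟩)
        · exact ⟨h3, h4.trans hsT⟩
        · exact ⟨by linarith, h4⟩
    have hdisj : Disjoint (ring n (T / 2 ^ m)) {y : E n | T / 2 ^ m < ‖y‖ ∧ ‖y‖ ≤ T} := by
      rw [Set.disjoint_left]
      intro y hy hy'
      exact absurd hy'.1 (not_lt.2 hy.2)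
    have hmeas : MeasurableSet {y : E n | T / 2 ^ m < ‖y‖ ∧ ‖y‖ ≤ T} :=
      (measurableSet_lt measurable_const measurable_norm).inter
        (measurableSet_le measurable_norm measurable_const)
    have hi1 : IntegrableOn (fun y => g y * baseKernel n φ y) (ring n (T / 2 ^ m)) :=
      (hint (T / 2 ^ m / 2) (by positivity)).mono_set fun y hy => hy.1.le
    have hi2 : IntegrableOn (fun y => g y * baseKernel n φ y)
        {y : E n | T / 2 ^ m < ‖y‖ ∧ ‖y‖ ≤ T} :=
      (hint _ hs).mono_set fun y hy => hy.1.le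
    rw [hunion, setIntegral_union hdisj hmeas hi1 hi2, pow_radius_succ,
      ← Ioc_union_Ioc_eq_Ioc (by linarith : T / 2 ^ m / 2 ≤ T / 2 ^ m) hsT]
    have hI : IntegrableOn (fun r => r / φ r) (Ioc 0 T) :=
      (integrableOn_Ioc_iff_integrableOn_Ioo).2 (h.integrableOn_lower h2 hT)
    rw [setIntegral_union (by simp) measurableSet_Ioc
      (hI.mono_set (Ioc_subset_Ioc (by positivity) hsT))
      (hI.mono_set (Ioc_subset_Ioc_left hs.le)), mul_add]
    exact add_le_add (integral_ring_ge h ha h1 hσ h2 hg hs hM hβ hi1 (hb m) (hbr m) (hbg m)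
      (hvol m)) ih

theorem le_of_forall_integral_Ioc_le (h : WeakScaling φ a σ₁ σ₂) (h2 : σ₂ < 2) {T c A : ℝ}
    (hT : 0 < T) (hA : ∀ m : ℕ, c * ∫ r in Ioc (T / 2 ^ m) T, r / φ r ≤ A) :
    c * lowerC φ T ≤ A := by
  have hI : IntegrableOn (fun r => r / φ r) (Ioc 0 T) :=
    (integrableOn_Ioc_iff_integrableOn_Ioo).2 (h.integrableOn_lower h2 hT)
  have hmono : Monotone fun m : ℕ => Ioc (T / 2 ^ m) T := fun i j hij =>
    Ioc_subset_Ioc_left (by gcongr; norm_num)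
  have hU : ⋃ m : ℕ, Ioc (T / 2 ^ m) T = Ioc 0 T := by
    ext r
    simp only [mem_iUnion, mem_Ioc]
    constructor
    · rintro ⟨m, h3, h4⟩
      exact ⟨lt_trans (by positivity) h3, h4⟩
    · rintro ⟨h3, h4⟩
      obtain ⟨m, hm⟩ := pow_unbounded_of_one_lt (T / r) (one_lt_two : (1 : ℝ) < 2)
      refine ⟨m, ?_, h4⟩
      rw [div_lt_iff₀ (by positivity)]
      rw [div_lt_iff₀ h3] at hm
      linarith
  have ht := tendsto_setIntegral_of_monotone (f := fun r => r / φ r) (μ := volume)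
    (fun m => measurableSet_Ioc) hmono (by rw [hU]; exact hI)
  rw [hU, integral_Ioc_eq_integral_Ioo] at ht
  exact le_of_tendsto' (ht.const_mul c) hA

theorem exists_ball_subset {x : E n} (hx : x ∈ Metric.ball (0 : E n) R) :
    ∃ ρ > 0, Metric.ball x ρ ⊆ Metric.ball 0 R :=
  Metric.isOpen_iff.1 Metric.isOpen_ball x hx

variable [NeZero n]

/-- The right-hand side is positive at every contact point where `u` is positive. -/
theorem rhs_pos (h : WeakScaling φ a σ₁ σ₂) (ha : 1 ≤ a) (h1 : 0 < σ₁)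
    (h2 : σ₂ < 2) {lam Lam : ℝ} (hlam : 0 < lam) (hl : lam ≤ Lam) (hR : 0 < R) {f : E n → ℝ}
    (hsub : IsViscositySubsolution (maxOp φ lam Lam) (fun x => -f x) (Metric.ball 0 R) u)
    (hout : ∀ x, x ∉ Metric.ball (0 : E n) R → u x ≤ 0)
    {x p : E n} (hx : x ∈ Metric.ball (0 : E n) R) (hux : 0 < u x)
    (hp : ∀ y ∈ Metric.ball (0 : E n) (3 * R), u y ≤ u x + inner ℝ p (y - x)) : 0 < f x := by
  obtain ⟨ρ, hρ, hball⟩ := exists_ball_subset hx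
  obtain ⟨B, hB⟩ := hsub.bounded
  refine lt_of_lt_of_le ?_ (viscosity_integral_le h ha h1 h2 hlam hl hR hsub hout hx hux.le hp hρ
    hball)
  have hC := h.normConst_pos ha h1 h2 n
  refine mul_pos (mul_pos hlam hC) ?_
  have hint := (integrableOn_secondDiff h ha h1 h2 hsub.aemeasurable hB x hρ).neg
  have hint' : IntegrableOn (fun y => -secondDiff u x y * baseKernel n φ y) {y | ρ ≤ ‖y‖} := by
    refine hint.congr (.of_forall fun y => ?_)
    simp
  rw [setIntegral_pos_iff_support_of_nonneg_ae _ hint']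
  -- Strict positivity comes from far away: for `|y| > 2R + ρ` both `x ± y` lie outside `B_R`, so
  -- the negated second difference is at least `2 u x > 0`.
  · have := nontrivial_E n
    have ho : IsOpen {y : E n | 2 * R + ρ < ‖y‖} := isOpen_lt continuous_const continuous_norm
    refine lt_of_lt_of_le (ho.measure_pos volume (NormedSpace.exists_lt_norm ℝ (E n) _))
      (measure_mono fun y hy => ?_)
    have hy' : 2 * R + ρ < ‖y‖ := hy
    have hxn : ‖x‖ < R := mem_ball_zero_iff.1 hx
    have h3 := hout (x + y) (by
      rw [mem_ball_zero_iff, not_lt]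
      have := norm_sub_le (x + y) x
      rw [add_sub_cancel_left] at this
      linarith)
    have h4 := hout (x - y) (by
      rw [mem_ball_zero_iff, not_lt]
      have := norm_sub_le x (x - y)
      rw [sub_sub_cancel] at this
      linarith)
    have hy0 : y ≠ 0 := norm_pos_iff.1 (by linarith)
    have h5 := h.baseKernel_pos hy0
    refine ⟨(mul_pos ?_ h5).ne', show ρ ≤ ‖y‖ by linarith⟩
    rw [secondDiff]
    linarith
  · exact .of_forall fun y => mul_nonneg
      (by have := secondDiff_nonpos hout hx hux.le hp y; linarith) (h.baseKernel_nonneg n y)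

/-- The constant in the measure estimate on annuli. -/
noncomputable def ringConst (n : ℕ) (lam a : ℝ) : ℝ := 32 * a ^ 2 * n * 16 ^ n / lam

/-- In some dyadic annulus around a contact point, `u` lies at most quadratically below the
supporting plane, outside a set of small measure. -/
theorem exists_good_ring (h : WeakScaling φ a σ₁ σ₂) (ha : 1 ≤ a) (h1 : 0 < σ₁) (hσ : 0 < σ₂)
    (h2 : σ₂ < 2) {lam Lam : ℝ} (hlam : 0 < lam) (hl : lam ≤ Lam) (hR : 0 < R) {f : E n → ℝ}
    (hsub : IsViscositySubsolution (maxOp φ lam Lam) (fun x => -f x) (Metric.ball 0 R) u)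
    (hout : ∀ x, x ∉ Metric.ball (0 : E n) R → u x ≤ 0)
    {x p : E n} (hx : x ∈ Metric.ball (0 : E n) R) (hux : 0 < u x)
    (hp : ∀ y ∈ Metric.ball (0 : E n) (3 * R), u y ≤ u x + inner ℝ p (y - x))
    {T : ℝ} (hT : 0 < T) (hTR : T ≤ R) :
    ∃ k : ℕ, volume {y : E n | y ∈ ring n (T / 2 ^ k) ∧ u (x + y) < u x + inner ℝ p y -
        ringConst n lam a * ((lowerC φ 1 + upperC φ 1) / lowerC φ T) * f x * (T / 2 ^ k) ^ 2} ≤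
      ENNReal.ofReal ((T / 2 ^ k / 16) ^ n * unitVol n / 4) := by
  by_contra hcon
  push Not at hcon
  have hf := rhs_pos h ha h1 h2 hlam hl hR hsub hout hx hux hp
  have hω := unitVol_pos n
  have hL := h.lowerC_pos h2 hT
  have hL1 := h.lowerC_pos h2 one_pos
  have hU1 := h.upperC_nonneg
  have hn : (0 : ℝ) < n := by exact_mod_cast NeZero.pos n
  have hC := h.normConst_pos ha h1 h2 n
  have hCi := h.inv_normConst_le ha h1 h2 n
  obtain ⟨B, hB⟩ := hsub.bounded
  have hδ := secondDiff_nonpos hout hx hux.le hp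
  have hxn : ‖x‖ < R := mem_ball_zero_iff.1 hx
  set M := ringConst n lam a * ((lowerC φ 1 + upperC φ 1) / lowerC φ T) * f x with hMdef
  have hM : 0 < M := by
    have : 0 < lowerC φ 1 + upperC φ 1 := by linarith
    unfold ringConst at hMdef
    rw [hMdef]; positivity
  set β := unitVol n / (4 * 16 ^ n) with hβdef
  have hβ : 0 < β := by positivity
  set b : ℕ → Set (E n) := fun k => {y : E n | y ∈ ring n (T / 2 ^ k) ∧
    u (x + y) < u x + inner ℝ p y - M * (T / 2 ^ k) ^ 2}
  have hint : ∀ ρ, 0 < ρ →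
      IntegrableOn (fun y => -secondDiff u x y * baseKernel n φ y) {y | ρ ≤ ‖y‖} := fun ρ hρ => by
    refine (integrableOn_secondDiff h ha h1 h2 hsub.aemeasurable hB x hρ).neg.congr
      (.of_forall fun y => ?_)
    simp
  have hb : ∀ k, NullMeasurableSet (b k) := fun k => by
    have hlt : NullMeasurableSet
        {y : E n | u (x + y) < u x + inner ℝ p y - M * (T / 2 ^ k) ^ 2} := by
      refine nullMeasurableSet_lt ?_ (by fun_prop : Continuous fun y : E n =>
        u x + inner ℝ p y - M * (T / 2 ^ k) ^ 2).aemeasurable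
      exact hsub.aemeasurable.comp_quasiMeasurePreserving
        (measurePreserving_add_left volume x).quasiMeasurePreserving
    exact (measurableSet_ring _).nullMeasurableSet.inter hlt
  -- At `x + y` the function is below the plane by `M (T / 2 ^ k)²`, at `x - y` it is at most the
  -- plane, and the linear parts cancel.
  have hbg : ∀ k, ∀ y ∈ b k, M * (T / 2 ^ k) ^ 2 ≤ -secondDiff u x y := fun k y hy => by
    have hyT : ‖y‖ ≤ T := hy.1.2.trans (div_le_self hT.le (one_le_pow₀ (by norm_num)))
    have h3 := hp (x - y) (by
      rw [mem_ball_zero_iff]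
      linarith [norm_sub_le x y])
    rw [sub_sub_cancel_left, inner_neg_right] at h3
    have h4 := hy.2
    rw [secondDiff]
    linarith
  have hvol : ∀ k, ENNReal.ofReal (β * (T / 2 ^ k) ^ n) ≤ volume (b k) := fun k => by
    refine le_trans (le_of_eq ?_) (hcon k).le
    congr 1
    rw [hβdef, div_pow (T / 2 ^ k)]
    field_simp
  have key : M * β / (2 * a ^ 2) * lowerC φ T ≤ f x / (lam * normConst n φ) := by
    refine le_of_forall_integral_Ioc_le h h2 hT fun m => ?_
    refine (integral_annulus_ge h ha h1 hσ h2 (g := fun y => -secondDiff u x y)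
      (fun y => by have := hδ y; linarith) hT hM.le hβ hint hb (fun k y hy => hy.1) hbg hvol
      m).trans ?_
    obtain ⟨ρ, hρ, hball⟩ := exists_ball_subset hx
    -- The excised ball must stay in `B_R` when centred at `x`, and must leave the annulus `|y| > T
    -- / 2 ^ m` in the domain of integration.
    have hρ' : 0 < min ρ (T / 2 ^ m) := lt_min hρ (by positivity)
    have hv := viscosity_integral_le h ha h1 h2 hlam hl hR hsub hout hx hux.le hp hρ'
      ((Metric.ball_subset_ball (min_le_left _ _)).trans hball)
    rw [le_div_iff₀ (by positivity), mul_comm]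
    refine le_trans (mul_le_mul_of_nonneg_left ?_ (by positivity)) hv
    refine setIntegral_mono_set (hint _ hρ') (.of_forall fun y => mul_nonneg
      (by have := hδ y; linarith) (h.baseKernel_nonneg n y)) (LE.le.eventuallyLE ?_)
    intro y hy
    exact (min_le_right _ _).trans hy.1.le
  -- `ringConst` is chosen so that this equals `4nω(C̲ + C̄) f x / lam`, with `ω` the volume of the
  -- unit ball: twice the bound from `inv_normConst_le`, hence the contradiction.
  have e : M * β / (2 * a ^ 2) * lowerC φ T =
      4 * (n * unitVol n * (lowerC φ 1 + upperC φ 1)) * (f x / lam) := by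
    rw [hMdef, hβdef, ringConst]
    field_simp
    ring
  have hfl : 0 < f x / lam := by positivity
  have e2 : f x / (lam * normConst n φ) = (normConst n φ)⁻¹ * (f x / lam) := by
    field_simp
  rw [e, e2] at key
  have := le_of_mul_le_mul_right key hfl
  have : 0 < (normConst n φ)⁻¹ := by positivity
  linarith

end Rings

/-! ### Elementary geometry of cubes. -/

section Cubes

variable {n : ℕ}

/-- The closed cube with centre `c` and side length `s`. -/
def closedCube (c : E n) (s : ℝ) : Set (E n) := {y | ∀ i, |y i - c i| ≤ s / 2}

theorem closedCube_subset_closedBall (c : E n) {s : ℝ} (hs : 0 ≤ s) :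
    closedCube c s ⊆ Metric.closedBall c (Real.sqrt n * s / 2) := by
  intro y hy
  rw [Metric.mem_closedBall, EuclideanSpace.dist_eq]
  refine Real.sqrt_le_iff.2 ⟨by positivity, ?_⟩
  calc ∑ i, dist (y i) (c i) ^ 2 ≤ ∑ _i : Fin n, (s / 2) ^ 2 := by
        refine Finset.sum_le_sum fun i _ => ?_
        rw [Real.dist_eq]
        have := hy i
        gcongr
    _ = (Real.sqrt n * s / 2) ^ 2 := by
        rw [Finset.sum_const, Finset.card_univ, Fintype.card_fin, nsmul_eq_mul, div_pow, div_pow,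
          mul_pow, Real.sq_sqrt (by positivity)]
        ring

theorem isClosed_closedCube (c : E n) (s : ℝ) : IsClosed (closedCube c s) := by
  have : closedCube c s = ⋂ i, {y : E n | |y i - c i| ≤ s / 2} := by
    ext y; simp [closedCube]
  rw [this]
  exact isClosed_iInter fun i => isClosed_le (by fun_prop) continuous_const

theorem cube_subset_closedCube (c : E n) (s : ℝ) : cube c s ⊆ closedCube c s :=
  fun _ hy i => (hy i).le

theorem closure_cube_eq (c : E n) {s : ℝ} (hs : 0 < s) : closure (cube c s) = closedCube c s := by
  refine Subset.antisymm
    (closure_minimal (cube_subset_closedCube c s) (isClosed_closedCube c s)) ?_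
  intro y hy
  have hlim : Filter.Tendsto (fun t : ℝ => c + t • (y - c)) (nhdsWithin 1 (Ioo 0 1)) (nhds y) := by
    have : Continuous fun t : ℝ => c + t • (y - c) := by fun_prop
    have h2 := this.tendsto 1
    rw [one_smul, add_sub_cancel] at h2
    exact h2.mono_left nhdsWithin_le_nhds
  have hne : (nhdsWithin (1 : ℝ) (Ioo 0 1)).NeBot := right_nhdsWithin_Ioo_neBot one_pos
  refine mem_closure_of_tendsto hlim ?_
  filter_upwards [self_mem_nhdsWithin] with t ht i
  have h1 := hy i
  have : (c + t • (y - c)) i - c i = t * (y i - c i) := by simp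
  rw [this, abs_mul, abs_of_pos ht.1]
  calc t * |y i - c i| ≤ t * (s / 2) := by gcongr; exact ht.1.le
    _ < 1 * (s / 2) := by gcongr; exact ht.2
    _ = s / 2 := one_mul _

theorem ball_subset_cube (c : E n) (t : ℝ) : Metric.ball c (t / 2) ⊆ cube c t := by
  intro y hy i
  have h1 := PiLp.norm_apply_le (y - c) i
  rw [Metric.mem_ball, dist_eq_norm] at hy
  rw [Real.norm_eq_abs] at h1
  exact lt_of_le_of_lt h1 hy

theorem diam_cube_le (c : E n) {s : ℝ} (hs : 0 ≤ s) : Metric.diam (cube c s) ≤ Real.sqrt n * s := by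
  have h1 := (cube_subset_closedCube c s).trans (closedCube_subset_closedBall c hs)
  refine (Metric.diam_mono h1 Metric.isBounded_closedBall).trans
    ((Metric.diam_closedBall (by positivity)).trans (le_of_eq (by ring)))

theorem le_diam_cube [NeZero n] (c : E n) {s : ℝ} (hs : 0 < s) : s / 2 ≤ Metric.diam (cube c s) := by
  have hb : Bornology.IsBounded (cube c s) := Metric.isBounded_closedBall.subset
    ((cube_subset_closedCube c s).trans (closedCube_subset_closedBall c hs.le))
  set e : E n := EuclideanSpace.single 0 (s / 4) with he
  have hen : ‖e‖ = s / 4 := by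
    rw [he, PiLp.norm_single, Real.norm_of_nonneg (by positivity)]
  have h1 : c + e ∈ cube c s := ball_subset_cube c s (by
    rw [Metric.mem_ball, dist_eq_norm, add_sub_cancel_left, hen]; linarith)
  have h2 : c - e ∈ cube c s := ball_subset_cube c s (by
    rw [Metric.mem_ball, dist_eq_norm, sub_sub_cancel_left, norm_neg, hen]; linarith)
  refine le_trans (le_of_eq ?_) (Metric.dist_le_diam_of_mem hb h1 h2)
  rw [dist_eq_norm, show c + e - (c - e) = (2 : ℝ) • e by module, norm_smul, hen,
    Real.norm_of_nonneg (by norm_num)]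
  ring

theorem volume_cube_le (c : E n) {s : ℝ} (hs : 0 ≤ s) :
    volume (cube c s) ≤ ENNReal.ofReal ((Real.sqrt n * s / 2) ^ n * unitVol n) := by
  rw [← volume_closedBall_eq c (by positivity)]
  exact measure_mono ((cube_subset_closedCube c s).trans (closedCube_subset_closedBall c hs))

theorem le_volume_cube (c : E n) {s : ℝ} (hs : 0 < s) :
    ENNReal.ofReal ((s / 2) ^ n * unitVol n) ≤ volume (cube c s) := by
  rw [← volume_ball_eq c (by positivity)]
  exact measure_mono (ball_subset_cube c s)

end Cubes

/-! ### Flatness of the envelope near a contact point. -/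

section Local

variable {n : ℕ} {u : E n → ℝ} {R : ℝ}

/-- A concave envelope is close to a supporting plane in a ball if `u` is close to that plane in
most of an annulus. -/
theorem plane_sub_le_concaveEnvelope [NeZero n] {B : ℝ} (hB : ∀ x, |u x| ≤ B) {x p : E n} {r t N : ℝ}
    (hr : 0 < r) (hball : Metric.closedBall x r ⊆ Metric.ball 0 (3 * R))
    (hbad : volume {y : E n | y ∈ ring n r ∧ u (x + y) < t + inner ℝ p y - N} ≤
      ENNReal.ofReal ((r / 16) ^ n * unitVol n / 4)) {z : E n} (hz : z ∈ Metric.ball x (r / 8)) :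
    t + inner ℝ p (z - x) - N ≤ concaveEnvelope u R z := by
  set b : Set (E n) := {y : E n | y ∈ ring n r ∧ u (x + y) < t + inner ℝ p y - N} with hb
  have hω := unitVol_pos n
  -- For `|w| < r / 8`, the balls of radius `r / 16` about `w ± e` stay between radii `9r / 16` and
  -- `15r / 16`, hence in the annulus. The reflection `y ↦ 2w - y` exchanges them.
  set e : E n := EuclideanSpace.single 0 (3 / 4 * r) with he
  have hen : ‖e‖ = 3 / 4 * r := by
    rw [he, PiLp.norm_single, Real.norm_of_nonneg (by positivity)]
  set w := z - x with hw
  have hwn : ‖w‖ < r / 8 := by rwa [Metric.mem_ball, dist_eq_norm] at hz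
  have hring : ∀ e' : E n, ‖e'‖ = 3 / 4 * r → ∀ y ∈ Metric.ball (w + e') (r / 16),
      y ∈ ring n r := by
    intro e' he' y hy
    rw [Metric.mem_ball, dist_eq_norm] at hy
    have h1 : ‖y‖ ≤ ‖y - (w + e')‖ + ‖w‖ + ‖e'‖ := by
      calc ‖y‖ = ‖(y - (w + e')) + w + e'‖ := by congr 1; abel
        _ ≤ _ := norm_add₃_le
    have h2 : ‖e'‖ ≤ ‖y‖ + ‖y - (w + e')‖ + ‖w‖ := by
      calc ‖e'‖ = ‖y - (y - (w + e')) - w‖ := by congr 1; abel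
        _ ≤ ‖y - (y - (w + e'))‖ + ‖w‖ := norm_sub_le _ _
        _ ≤ _ := by gcongr; exact norm_sub_le _ _
    constructor <;> linarith
  have hpre : volume ((fun y : E n => (2 : ℝ) • w - y) ⁻¹' b) = volume b :=
    (Measure.measurePreserving_sub_left volume ((2 : ℝ) • w)).measure_preimage_emb
      (MeasurableEquiv.subLeft ((2 : ℝ) • w)).measurableEmbedding b
  -- The bad set and its reflection each have at most a quarter of the volume of the ball, so some
  -- `y` is good together with `2w - y`; the midpoint of `x + y` and `x + 2w - y` is `z`.
  have hnot : ¬ Metric.ball (w + e) (r / 16) ⊆ b ∪ (fun y : E n => (2 : ℝ) • w - y) ⁻¹' b := by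
    intro hsub
    have h1 := (measure_mono hsub).trans (measure_union_le (μ := volume) _ _)
    rw [hpre, volume_ball_eq _ (by positivity)] at h1
    have h2 := h1.trans (add_le_add hbad hbad)
    rw [← ENNReal.ofReal_add (by positivity) (by positivity),
      ENNReal.ofReal_le_ofReal_iff (by positivity)] at h2
    have : 0 < (r / 16) ^ n * unitVol n := by positivity
    linarith
  obtain ⟨y, hyD, hyb⟩ := not_subset.1 hnot
  rw [mem_union, not_or] at hyb
  have hy1 : y ∈ ring n r := hring e hen y hyD
  have hy2 : (2 : ℝ) • w - y ∈ ring n r := by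
    refine hring (-e) (by rw [norm_neg, hen]) _ ?_
    rw [Metric.mem_ball, dist_eq_norm] at hyD ⊢
    rwa [show (2 : ℝ) • w - y - (w + -e) = -(y - (w + e)) by module, norm_neg]
  have hu1 : t + inner ℝ p y - N ≤ u (x + y) := by
    by_contra hlt
    exact hyb.1 ⟨hy1, not_le.1 hlt⟩
  have hu2 : t + inner ℝ p ((2 : ℝ) • w - y) - N ≤ u (x + ((2 : ℝ) • w - y)) := by
    by_contra hlt
    exact hyb.2 ⟨hy2, not_le.1 hlt⟩
  have hm1 : x + y ∈ Metric.ball (0 : E n) (3 * R) := hball (by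
    rw [Metric.mem_closedBall, dist_eq_norm, add_sub_cancel_left]; exact hy1.2)
  have hm2 : x + ((2 : ℝ) • w - y) ∈ Metric.ball (0 : E n) (3 * R) := hball (by
    rw [Metric.mem_closedBall, dist_eq_norm, add_sub_cancel_left]; exact hy2.2)
  have h1 := (le_max_left _ _).trans (max_le_concaveEnvelope hB hm1)
  have h2 := (le_max_left _ _).trans (max_le_concaveEnvelope hB hm2)
  have hc := (concaveOn_concaveEnvelope (R := R) hB).2 hm1 hm2
    (by norm_num : (0 : ℝ) ≤ 1 / 2) (by norm_num : (0 : ℝ) ≤ 1 / 2) (by norm_num)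
  have hmid : (1 / 2 : ℝ) • (x + y) + (1 / 2 : ℝ) • (x + ((2 : ℝ) • w - y)) = z := by
    rw [hw]; module
  rw [hmid, smul_eq_mul, smul_eq_mul] at hc
  rw [inner_sub_right, inner_smul_right] at hu2
  linarith

/-- If `q` is a slope at `w`, a step `d` of length `r / 32` in the direction `p - q` stays in
`B_{r/8}(x)`. As `Γ` is trapped in a slab of height `N` below the plane of slope `p`, the gain `⟨p -
q, d⟩` is at most `N`. -/
theorem gradImage_subset_closedBall {Γ : E n → ℝ} {U S : Set (E n)} {x p : E n} {r t N : ℝ}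
    (hr : 0 < r) (hU : Metric.ball x (r / 8) ⊆ U) (hS : S ⊆ Metric.closedBall x (r / 16))
    (hup : ∀ y ∈ U, Γ y ≤ t + inner ℝ p (y - x))
    (hlow : ∀ y ∈ Metric.ball x (r / 8), t + inner ℝ p (y - x) - N ≤ Γ y) :
    gradImage Γ U S ⊆ Metric.closedBall p (32 * N / r) := by
  rintro q ⟨w, ⟨hwS, hwU⟩, hq⟩
  rw [Metric.mem_closedBall, dist_comm, dist_eq_norm]
  have hN : 0 ≤ N := by
    have h1 := hlow x (Metric.mem_ball_self (by positivity))
    have h2 := hup x (hU (Metric.mem_ball_self (by positivity)))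
    linarith
  by_cases hpq : p - q = 0
  · rw [hpq, norm_zero]; positivity
  have hpos : 0 < ‖p - q‖ := norm_pos_iff.2 hpq
  set d : E n := (r / 32 / ‖p - q‖) • (p - q) with hd
  have hdn : ‖d‖ = r / 32 := by
    rw [hd, norm_smul, Real.norm_of_nonneg (by positivity)]; field_simp
  have hwx := hS hwS
  rw [Metric.mem_closedBall, dist_eq_norm] at hwx
  have hy : w + d ∈ Metric.ball x (r / 8) := by
    rw [Metric.mem_ball, dist_eq_norm]
    calc ‖w + d - x‖ = ‖(w - x) + d‖ := by congr 1; abel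
      _ ≤ ‖w - x‖ + ‖d‖ := norm_add_le _ _
      _ < r / 8 := by linarith
  have h1 := hlow _ hy
  have h2 := hq _ (hU hy)
  have h3 := hup w hwU
  rw [add_sub_cancel_left] at h2
  rw [show w + d - x = (w - x) + d by abel, inner_add_right] at h1
  have h4 : inner ℝ (p - q) d ≤ N := by
    rw [inner_sub_left]; linarith
  rw [hd, inner_smul_right, real_inner_self_eq_norm_sq] at h4
  have h5 : r / 32 / ‖p - q‖ * ‖p - q‖ ^ 2 = ‖p - q‖ * r / 32 := by field_simp
  rw [le_div_iff₀ hr]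
  linarith

end Local

/-! ### Dyadic grids and the stopping-time covering. -/

section Grid

variable {n : ℕ}

/-- The index of the grid cube of side `h` containing `y`. -/
noncomputable def gridIndex (h : ℝ) (y : E n) : Fin n → ℤ := fun i => ⌊y i / h⌋

/-- The centre of the grid cube of side `h` with index `k`. -/
noncomputable def gridCenter (h : ℝ) (k : Fin n → ℤ) : E n :=
  WithLp.toLp 2 fun i => ((k i : ℝ) + 1 / 2) * h

theorem mem_closedCube_gridCenter {h : ℝ} (hh : 0 < h) {k : Fin n → ℤ} {y : E n} :
    y ∈ closedCube (gridCenter h k) h ↔ ∀ i, (k i : ℝ) ≤ y i / h ∧ y i / h ≤ k i + 1 := by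
  refine forall_congr' fun i => ?_
  rw [abs_le, le_div_iff₀ hh, div_le_iff₀ hh]
  simp only [gridCenter]
  constructor <;> rintro ⟨h1, h2⟩ <;> constructor <;> linarith

theorem gridIndex_eq_of_mem_cube {h : ℝ} (hh : 0 < h) {k : Fin n → ℤ} {y : E n}
    (hy : y ∈ cube (gridCenter h k) h) : gridIndex h y = k := by
  ext i
  have h1 := abs_lt.1 (hy i)
  simp only [gridCenter] at h1
  rw [gridIndex, Int.floor_eq_iff, le_div_iff₀ hh, div_lt_iff₀ hh]
  constructor <;> linarith

theorem mem_closedCube_gridIndex {h : ℝ} (hh : 0 < h) (y : E n) :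
    y ∈ closedCube (gridCenter h (gridIndex h y)) h :=
  (mem_closedCube_gridCenter hh).2 fun _ => ⟨Int.floor_le _, (Int.lt_floor_add_one _).le⟩

/-- Dyadic nesting: the floor of `t / 2 ^ (j - i)` depends only on the floor of `t`. -/
theorem gridIndex_coarsen {s : ℝ} {i j : ℕ} (hij : i ≤ j) {y z : E n}
    (h : gridIndex (s / 2 ^ j) y = gridIndex (s / 2 ^ j) z) :
    gridIndex (s / 2 ^ i) y = gridIndex (s / 2 ^ i) z := by
  ext l
  have h1 : ⌊y l / (s / 2 ^ j)⌋ = ⌊z l / (s / 2 ^ j)⌋ := congrFun h l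
  have key : ∀ t : ℝ, t / (s / 2 ^ i) = t / (s / 2 ^ j) / ((2 ^ (j - i) : ℕ) : ℝ) := by
    intro t
    have : (2 : ℝ) ^ j = 2 ^ i * 2 ^ (j - i) := by rw [← pow_add, Nat.add_sub_cancel' hij]
    push_cast
    rw [this]
    by_cases hs : s = 0
    · simp [hs]
    field_simp
  rw [gridIndex, gridIndex, key, key, Int.floor_div_natCast, Int.floor_div_natCast, h1]

/-- Near `x`, every point lies in a grid cube whose closure contains `x`. -/
theorem eventually_mem_closedCube_gridIndex {h : ℝ} (hh : 0 < h) (x : E n) :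
    ∀ᶠ y in nhds x, x ∈ closedCube (gridCenter h (gridIndex h y)) h := by
  simp only [mem_closedCube_gridCenter hh, gridIndex]
  refine Filter.eventually_all.2 fun i => ?_
  have hc : Filter.Tendsto (fun y : E n => y i / h) (nhds x) (nhds (x i / h)) :=
    (by fun_prop : Continuous fun y : E n => y i / h).tendsto x
  have h1 : (⌈x i / h⌉ : ℝ) - 1 < x i / h := by linarith [Int.ceil_lt_add_one (x i / h)]
  filter_upwards [hc.eventually (lt_mem_nhds h1),
    hc.eventually (gt_mem_nhds (Int.lt_floor_add_one (x i / h)))] with y hy1 hy2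
  constructor
  · have : ⌊y i / h⌋ ≤ ⌊x i / h⌋ := Int.lt_add_one_iff.1 (Int.floor_lt.2 (by exact_mod_cast hy2))
    exact (Int.cast_le.2 this).trans (Int.floor_le _)
  · have : ⌈x i / h⌉ - 1 ≤ ⌊y i / h⌋ := Int.le_floor.2 (by exact_mod_cast hy1.le)
    have h3 : (⌈x i / h⌉ : ℝ) ≤ ⌊y i / h⌋ + 1 := by exact_mod_cast (by linarith)
    exact (Int.le_ceil _).trans h3

theorem finite_gridIndex_image {S : Set (E n)} (hS : Bornology.IsBounded S) {h : ℝ} (hh : 0 < h) :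
    (gridIndex h '' S).Finite := by
  obtain ⟨r, hr⟩ := hS.subset_closedBall 0
  refine (Set.finite_Icc (fun _ : Fin n => ⌊-r / h⌋) (fun _ => ⌊r / h⌋)).subset ?_
  rintro _ ⟨y, hy, rfl⟩
  have h1 := mem_closedBall_zero_iff.1 (hr hy)
  have h2 : ∀ i, |y i| ≤ r := fun i => (PiLp.norm_apply_le y i).trans h1
  exact ⟨fun i => Int.floor_le_floor (by have := (abs_le.1 (h2 i)).1; gcongr),
    fun i => Int.floor_le_floor (by have := (abs_le.1 (h2 i)).2; gcongr)⟩

/-- A stopping-time selection of dyadic cubes: if every point of a compact set `S` has a scale at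
which all cubes containing it are good, then `S` is covered by finitely many disjoint good cubes. -/
theorem exists_good_dyadic_cover {S : Set (E n)} (hS : IsCompact S) {s₀ : ℝ} (hs₀ : 0 < s₀)
    {Good : E n → ℝ → Prop}
    (hgood : ∀ x ∈ S, ∃ k : ℕ, ∀ c : E n, x ∈ closure (cube c (s₀ / 2 ^ k)) →
      Good c (s₀ / 2 ^ k)) :
    ∃ (m : ℕ) (c : Fin m → E n) (s : Fin m → ℝ),
      (∀ j, 0 < s j ∧ s j ≤ s₀) ∧
      (∀ i j, i ≠ j → Disjoint (cube (c i) (s i)) (cube (c j) (s j))) ∧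
      (∀ j, (S ∩ closure (cube (c j) (s j))).Nonempty) ∧
      (S ⊆ ⋃ j, closure (cube (c j) (s j))) ∧
      ∀ j, Good (c j) (s j) := by
  classical
  have hpos : ∀ k : ℕ, 0 < s₀ / 2 ^ k := fun k => by positivity
  let P : ℕ → E n → Prop := fun k y =>
    Good (gridCenter (s₀ / 2 ^ k) (gridIndex (s₀ / 2 ^ k) y)) (s₀ / 2 ^ k)
  -- Goodness at `x` covers every cube whose closure contains `x`, hence the grid cubes of all
  -- nearby points at the same scale. Compactness then bounds the stopping scale.
  have hbound : ∃ J : ℕ, ∀ y ∈ S, ∃ k ≤ J, P k y := by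
    choose! κ hκ using hgood
    obtain ⟨t, htS, ht⟩ := hS.elim_nhds_subcover
      (fun x => {y | x ∈ closedCube (gridCenter (s₀ / 2 ^ κ x) (gridIndex (s₀ / 2 ^ κ x) y))
        (s₀ / 2 ^ κ x)})
      (fun x _ => eventually_mem_closedCube_gridIndex (hpos _) x)
    refine ⟨t.sup κ, fun y hy => ?_⟩
    obtain ⟨x, hxt, hxy⟩ := mem_iUnion₂.1 (ht hy)
    refine ⟨κ x, Finset.le_sup hxt, hκ x (htS x hxt) _ ?_⟩
    rw [closure_cube_eq _ (hpos _)]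
    exact hxy
  obtain ⟨J, hJ⟩ := hbound
  have hex : ∀ y ∈ S, ∃ k, P k y := fun y hy => (hJ y hy).imp fun _ h => h.2
  -- The selected cubes: for each point of `S`, the largest good grid cube containing it.
  let F : Set (ℕ × (Fin n → ℤ)) :=
    {q | ∃ y ∈ S, q.2 = gridIndex (s₀ / 2 ^ q.1) y ∧ P q.1 y ∧ ∀ i < q.1, ¬ P i y}
  have hFfin : F.Finite := by
    have : (⋃ k ∈ Finset.range (J + 1),
        (fun z => (k, z)) '' (gridIndex (s₀ / 2 ^ k) '' S)).Finite :=
      (Finset.range (J + 1)).finite_toSet.biUnion fun k _ =>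
        (finite_gridIndex_image hS.isBounded (hpos k)).image _
    refine this.subset ?_
    rintro ⟨k, z⟩ ⟨y, hy, hz, -, hmin⟩
    obtain ⟨k', hk', hP⟩ := hJ y hy
    have hkk : k ≤ k' := by
      by_contra hlt
      exact hmin k' (not_le.1 hlt) hP
    refine mem_iUnion₂.2 ⟨k, Finset.mem_range.2 (by omega), z, ⟨y, hy, hz.symm⟩, rfl⟩
  -- If two selected cubes meet, the coarser one contains the finer. Being good, it would have
  -- stopped the point that selected the finer one, so the scales agree.
  have hsep : ∀ q ∈ F, ∀ q' ∈ F, q.1 ≤ q'.1 → ∀ z,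
      z ∈ cube (gridCenter (s₀ / 2 ^ q.1) q.2) (s₀ / 2 ^ q.1) →
      z ∈ cube (gridCenter (s₀ / 2 ^ q'.1) q'.2) (s₀ / 2 ^ q'.1) → q = q' := by
    rintro ⟨k, a⟩ ⟨y, -, ha, hPy, -⟩ ⟨k', a'⟩ ⟨y', -, ha', -, hmin'⟩ hle z hz hz'
    have e1 := gridIndex_eq_of_mem_cube (hpos _) hz
    have e2 := gridIndex_eq_of_mem_cube (hpos _) hz'
    simp only at ha ha' hle e1 e2 hPy hmin'
    have e3 := gridIndex_coarsen hle (e2.trans ha')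
    have hPy' : P k y' := by
      have : gridIndex (s₀ / 2 ^ k) y' = gridIndex (s₀ / 2 ^ k) y := by
        rw [← e3, e1, ha]
      simp only [P, this]
      exact hPy
    have hkk : k = k' := by
      by_contra hne
      exact hmin' k (lt_of_le_of_ne hle hne) hPy'
    subst hkk
    rw [← e1, ← e2]
  have := hFfin.fintype
  let e := Fintype.equivFin F
  refine ⟨Fintype.card F,
    fun j => gridCenter (s₀ / 2 ^ (e.symm j).1.1) (e.symm j).1.2,
    fun j => s₀ / 2 ^ (e.symm j).1.1,
    fun j => ⟨hpos _, div_le_self hs₀.le (one_le_pow₀ (by norm_num))⟩, ?_, ?_, ?_, ?_⟩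
  · intro i j hij
    rw [Set.disjoint_left]
    intro z hz hz'
    apply hij
    apply e.symm.injective
    apply Subtype.ext
    rcases le_total (e.symm i).1.1 (e.symm j).1.1 with hle | hle
    · exact hsep _ (e.symm i).2 _ (e.symm j).2 hle z hz hz'
    · exact (hsep _ (e.symm j).2 _ (e.symm i).2 hle z hz' hz).symm
  · intro j
    obtain ⟨y, hy, hq, -, -⟩ := (e.symm j).2
    refine ⟨y, hy, ?_⟩
    rw [closure_cube_eq _ (hpos _)]
    simp only [hq]
    exact mem_closedCube_gridIndex (hpos _) y
  · intro y hy
    have hk := Nat.find_spec (hex y hy)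
    have hmin : ∀ i < Nat.find (hex y hy), ¬ P i y := fun i hi => Nat.find_min (hex y hy) hi
    set k := Nat.find (hex y hy)
    let q : F := ⟨(k, gridIndex (s₀ / 2 ^ k) y), y, hy, rfl, hk, hmin⟩
    refine mem_iUnion.2 ⟨e q, ?_⟩
    simp only [Equiv.symm_apply_apply]
    rw [closure_cube_eq _ (hpos _)]
    exact mem_closedCube_gridIndex (hpos _) y
  · intro j
    obtain ⟨y, hy, hq, hP, -⟩ := (e.symm j).2
    simp only [hq]
    exact hP

end Grid

/-! ### From a good annulus to a good cube, and the theorem. -/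

section Main

variable {n : ℕ} {u f : E n → ℝ} {R : ℝ} {φ : ℝ → ℝ} {a σ₁ σ₂ : ℝ}

theorem r0_pos (n : ℕ) [NeZero n] (σ : ℝ) (hR : 0 < R) : 0 < r0 n σ R := by
  have : (0 : ℝ) < n := by exact_mod_cast NeZero.pos n
  unfold r0
  positivity

theorem r0_le (n : ℕ) [NeZero n] {σ : ℝ} (hσ : σ < 2) (hR : 0 < R) : r0 n σ R ≤ R := by
  have hn : (1 : ℝ) ≤ n := by exact_mod_cast NeZero.one_le
  have h1 : (2 : ℝ) ^ (-1 / (2 - σ)) ≤ 1 := Real.rpow_le_one_of_one_le_of_nonpos (by norm_num)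
    (div_nonpos_of_nonpos_of_nonneg (by norm_num) (by linarith))
  have h2 : 1 / (2 ^ 8 * (n : ℝ)) ≤ 1 := by
    rw [div_le_one (by positivity)]
    nlinarith
  unfold r0
  calc 1 / (2 ^ 8 * (n : ℝ)) * (2 : ℝ) ^ (-1 / (2 - σ)) * R ≤ 1 * 1 * R := by gcongr
    _ = R := by ring

/-- The estimates of the theorem for the cube with centre `c` and side length `s`, with constant `C`
and scale factor `A`. -/
def IsGoodCube (u f : E n → ℝ) (R C A : ℝ) (c : E n) (s : ℝ) : Prop :=
  volume (gradImage (concaveEnvelope u R) (Metric.ball 0 (3 * R)) (closure (cube c s))) ≤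
      ENNReal.ofReal (C * (A * sSup (f '' (closure (cube c s) ∩ Metric.ball 0 R))) ^ n) *
        volume (cube c s) ∧
    ENNReal.ofReal (1 / 2) * volume (cube c s) ≤
      volume {y | y ∈ cube c (32 * Real.sqrt n * s) ∧
        concaveEnvelope u R y - C * A * sSup (f '' (closure (cube c s) ∩ Metric.ball 0 R)) *
          Metric.diam (cube c s) ^ 2 < u y}

/-- The constant of the theorem. -/
noncomputable def abpConst (n : ℕ) (lam a : ℝ) : ℝ :=
  (1024 * Real.sqrt n * ringConst n lam a) ^ n + 2048 * n * ringConst n lam a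

theorem ringConst_pos (n : ℕ) [NeZero n] {lam a : ℝ} (hlam : 0 < lam) (ha : 1 ≤ a) :
    0 < ringConst n lam a := by
  have : (0 : ℝ) < n := by exact_mod_cast NeZero.pos n
  unfold ringConst
  positivity

theorem abpConst_pos (n : ℕ) [NeZero n] {lam a : ℝ} (hlam : 0 < lam) (ha : 1 ≤ a) :
    0 < abpConst n lam a := by
  have := ringConst_pos n hlam ha
  have : (0 : ℝ) < n := by exact_mod_cast NeZero.pos n
  unfold abpConst
  positivity

/-- The side is chosen so that `√n s = r / 16`: the closed cube lies in `B̄_{r/16}(x)`, where the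
slopes of `Γ` are controlled, while the dilated cube has side `2r` and contains a ball of radius `r
/ 16` inside the annulus around `x`. The first summand of the constant serves the gradient estimate,
the second the measure estimate. -/
theorem isGoodCube_of_ring [NeZero n] {B : ℝ} (hB : ∀ x, |u x| ≤ B) {x p : E n} {r A κ : ℝ}
    (hr : 0 < r) (hrR : r ≤ R) (hx : x ∈ Metric.ball (0 : E n) R)
    (hp : ∀ y ∈ Metric.ball (0 : E n) (3 * R), max (u y) 0 ≤ u x + inner ℝ p (y - x))
    (hA : 0 < A) (hκ : 0 < κ) (hfx : 0 < f x) (hf : BddAbove (f '' Metric.ball 0 R))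
    (hbad : volume {y : E n | y ∈ ring n r ∧ u (x + y) < u x + inner ℝ p y - κ * A * f x * r ^ 2} ≤
      ENNReal.ofReal ((r / 16) ^ n * unitVol n / 4)) {c : E n}
    (hc : x ∈ closure (cube c (r / (16 * Real.sqrt n)))) :
    IsGoodCube u f R ((1024 * Real.sqrt n * κ) ^ n + 2048 * n * κ) A c
      (r / (16 * Real.sqrt n)) := by
  have hn : (0 : ℝ) < n := by exact_mod_cast NeZero.pos n
  have hsn : 0 < Real.sqrt n := Real.sqrt_pos.2 hn
  have hsq : Real.sqrt n ^ 2 = n := Real.sq_sqrt hn.le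
  have hω := unitVol_pos n
  set s := r / (16 * Real.sqrt n) with hs
  have hs0 : 0 < s := by positivity
  have hss : Real.sqrt n * s = r / 16 := by rw [hs]; field_simp
  set M := sSup (f '' (closure (cube c s) ∩ Metric.ball 0 R)) with hM
  have hfM : f x ≤ M := le_csSup (hf.mono (image_mono inter_subset_right)) ⟨x, ⟨hc, hx⟩, rfl⟩
  have hM0 : 0 < M := hfx.trans_le hfM
  have hball : Metric.closedBall x r ⊆ Metric.ball (0 : E n) (3 * R) := by
    intro y hy
    rw [mem_ball_zero_iff] at hx ⊢
    rw [Metric.mem_closedBall, dist_eq_norm] at hy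
    have : ‖y‖ ≤ ‖y - x‖ + ‖x‖ := by simpa using norm_add_le (y - x) x
    linarith
  have hup : ∀ y ∈ Metric.ball (0 : E n) (3 * R),
      concaveEnvelope u R y ≤ u x + inner ℝ p (y - x) := fun y hy =>
    concaveEnvelope_le_of_plane hp hy
  rw [closure_cube_eq _ hs0] at hc
  have hxc := closedCube_subset_closedBall c hs0.le hc
  rw [hss, Metric.mem_closedBall] at hxc
  constructor
  · have hlow := fun y hy => plane_sub_le_concaveEnvelope hB hr hball hbad (z := y) hy
    have hS : closure (cube c s) ⊆ Metric.closedBall x (r / 16) := by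
      rw [closure_cube_eq _ hs0]
      intro y hy
      have hyc := closedCube_subset_closedBall c hs0.le hy
      rw [hss, Metric.mem_closedBall] at hyc
      rw [Metric.mem_closedBall]
      linarith [dist_triangle_right y x c]
    have hsub := gradImage_subset_closedBall hr
      ((Metric.ball_subset_closedBall.trans (Metric.closedBall_subset_closedBall
        (by linarith))).trans hball) hS hup hlow
    calc volume (gradImage (concaveEnvelope u R) (Metric.ball 0 (3 * R)) (closure (cube c s)))
        ≤ volume (Metric.closedBall p (32 * (κ * A * f x * r ^ 2) / r)) := measure_mono hsub
      _ = ENNReal.ofReal ((32 * (κ * A * f x * r ^ 2) / r) ^ n * unitVol n) :=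
          volume_closedBall_eq _ (by positivity)
      _ ≤ ENNReal.ofReal ((((1024 * Real.sqrt n * κ) ^ n + 2048 * n * κ) * (A * M) ^ n) *
            ((s / 2) ^ n * unitVol n)) := by
          refine ENNReal.ofReal_le_ofReal ?_
          calc (32 * (κ * A * f x * r ^ 2) / r) ^ n * unitVol n
              ≤ (32 * (κ * A * M * r ^ 2) / r) ^ n * unitVol n := by gcongr
            _ = (1024 * Real.sqrt n * κ) ^ n * (A * M) ^ n * ((s / 2) ^ n * unitVol n) := by
                rw [← mul_pow, ← mul_assoc (_ ^ n), ← mul_pow]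
                congr 2
                rw [hs]
                field_simp
                ring
            _ ≤ _ := by
                gcongr
                have : 0 < 2048 * n * κ := by positivity
                linarith
      _ = ENNReal.ofReal (((1024 * Real.sqrt n * κ) ^ n + 2048 * n * κ) * (A * M) ^ n) *
            ENNReal.ofReal ((s / 2) ^ n * unitVol n) := ENNReal.ofReal_mul (by positivity)
      _ ≤ _ := by gcongr; exact le_volume_cube c hs0
  · set b : Set (E n) :=
      {y : E n | y ∈ ring n r ∧ u (x + y) < u x + inner ℝ p y - κ * A * f x * r ^ 2}
    set e : E n := EuclideanSpace.single 0 (3 / 4 * r) with he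
    have hen : ‖e‖ = 3 / 4 * r := by
      rw [he, PiLp.norm_single, Real.norm_of_nonneg (by positivity)]
    set D := Metric.ball e (r / 16)
    set G := {y | y ∈ cube c (32 * Real.sqrt n * s) ∧
      concaveEnvelope u R y - ((1024 * Real.sqrt n * κ) ^ n + 2048 * n * κ) * A * M *
        Metric.diam (cube c s) ^ 2 < u y}
    have hDG : D \ b ⊆ (fun y => x + y) ⁻¹' G := by
      rintro y ⟨hyD, hyb⟩
      rw [Metric.mem_ball, dist_eq_norm] at hyD
      have hy1 : ‖y‖ ≤ ‖y - e‖ + ‖e‖ := by simpa using norm_add_le (y - e) e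
      have hy2 : ‖e‖ ≤ ‖y‖ + ‖y - e‖ := by simpa using norm_sub_le y (y - e)
      have hyr : y ∈ ring n r := by constructor <;> linarith
      have hgood : u x + inner ℝ p y - κ * A * f x * r ^ 2 ≤ u (x + y) := by
        by_contra hlt
        exact hyb ⟨hyr, not_le.1 hlt⟩
      have hΓ := hup (x + y) (hball (by
        rw [Metric.mem_closedBall, dist_eq_norm, add_sub_cancel_left]; exact hyr.2))
      rw [add_sub_cancel_left] at hΓ
      refine ⟨ball_subset_cube _ _ ?_, ?_⟩
      · rw [Metric.mem_ball]
        have h1 := dist_triangle (x + y) x c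
        have h2 : dist (x + y) x = ‖y‖ := by rw [dist_eq_norm, add_sub_cancel_left]
        have h3 : 32 * Real.sqrt n * s / 2 = r := by
          rw [show 32 * Real.sqrt n * s / 2 = 16 * (Real.sqrt n * s) by ring, hss]; ring
        rw [h3]
        linarith
      -- With `r = 32√n (s / 2)` and `s / 2 ≤ diam` this gives `1024n`; the constant carries `2048n`
      -- to make the next inequality strict.
      · have hd : r ^ 2 ≤ 1024 * n * Metric.diam (cube c s) ^ 2 := by
          have h1 : (s / 2) ^ 2 ≤ Metric.diam (cube c s) ^ 2 := by
            have := le_diam_cube c hs0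
            gcongr
          calc r ^ 2 = 1024 * n * (s / 2) ^ 2 := by
                rw [hs, div_pow, div_pow, mul_pow, hsq]; field_simp; ring
            _ ≤ _ := by gcongr
        have h4 : κ * A * f x * r ^ 2 < ((1024 * Real.sqrt n * κ) ^ n + 2048 * n * κ) * A * M *
            Metric.diam (cube c s) ^ 2 := by
          calc κ * A * f x * r ^ 2 ≤ κ * A * M * (1024 * n * Metric.diam (cube c s) ^ 2) := by gcongr
            _ < 2 * (κ * A * M * (1024 * n * Metric.diam (cube c s) ^ 2)) := by
                have : 0 < Metric.diam (cube c s) :=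
                  lt_of_lt_of_le (by positivity) (le_diam_cube c hs0)
                have : 0 < κ * A * M * (1024 * n * Metric.diam (cube c s) ^ 2) := by positivity
                linarith
            _ = (2048 * n * κ) * A * M * Metric.diam (cube c s) ^ 2 := by ring
            _ ≤ _ := by
                gcongr
                have : 0 ≤ (1024 * Real.sqrt n * κ) ^ n := by positivity
                linarith
        linarith
    have hvG : volume ((fun y => x + y) ⁻¹' G) = volume G := measure_preimage_add volume x G
    rw [← hvG]
    calc ENNReal.ofReal (1 / 2) * volume (cube c s)
        ≤ ENNReal.ofReal (1 / 2) * ENNReal.ofReal ((Real.sqrt n * s / 2) ^ n * unitVol n) := by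
          gcongr
          exact volume_cube_le c hs0.le
      _ = ENNReal.ofReal (1 / 2 * ((Real.sqrt n * s / 2) ^ n * unitVol n)) :=
          (ENNReal.ofReal_mul (by norm_num)).symm
      -- The cube lies in a ball of radius `r / 32`, and at least three quarters of the ball `D` of
      -- radius `r / 16` is good, so the fraction `1 / 2` is available.
      _ ≤ ENNReal.ofReal ((r / 16) ^ n * unitVol n - (r / 16) ^ n * unitVol n / 4) := by
          refine ENNReal.ofReal_le_ofReal ?_
          have h1 : (Real.sqrt n * s / 2) ^ n ≤ (r / 16) ^ n := by
            rw [hss]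
            exact pow_le_pow_left₀ (by positivity) (by linarith) n
          have h2 : (Real.sqrt n * s / 2) ^ n * unitVol n ≤ (r / 16) ^ n * unitVol n := by gcongr
          have h3 : 0 < (r / 16) ^ n * unitVol n := by positivity
          linarith
      _ = volume D - ENNReal.ofReal ((r / 16) ^ n * unitVol n / 4) := by
          rw [ENNReal.ofReal_sub _ (by positivity), ← volume_ball_eq e (by positivity)]
      _ ≤ volume D - volume b := by gcongr
      _ ≤ volume (D \ b) := le_measure_sdiff
      _ ≤ _ := measure_mono hDG

theorem exists_isGoodCube [NeZero n] (h : WeakScaling φ a σ₁ σ₂) (ha : 1 ≤ a) (h1 : 0 < σ₁)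
    (h12 : σ₁ ≤ σ₂) (h2 : σ₂ < 2) {lam Lam : ℝ} (hlam : 0 < lam) (hl : lam ≤ Lam) (hR : 0 < R)
    (hf : BddAbove (f '' Metric.ball 0 R))
    (hsub : IsViscositySubsolution (maxOp φ lam Lam) (fun x => -f x) (Metric.ball 0 R) u)
    (hout : ∀ x, x ∉ Metric.ball (0 : E n) R → u x ≤ 0) (hpos : ∃ x, 0 < u x)
    {x : E n} (hx : x ∈ contactSet u R) :
    ∃ k : ℕ, ∀ c : E n, x ∈ closure (cube c (r0 n σ₁ R / (16 * Real.sqrt n) / 2 ^ k)) →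
      IsGoodCube u f R (abpConst n lam a) (scaleFactor n φ σ₁ R) c
        (r0 n σ₁ R / (16 * Real.sqrt n) / 2 ^ k) := by
  obtain ⟨B, hB⟩ := hsub.bounded
  obtain ⟨x₁, hx₁⟩ := hpos
  obtain ⟨hxR, hxΓ⟩ := hx
  have hx₁R : ‖x₁‖ ≤ R := by
    by_contra hlt
    exact absurd (hout x₁ (by rw [mem_ball_zero_iff]; intro h'; exact hlt h'.le)) (not_le.2 hx₁)
  have hux : 0 < u x := by
    have := concaveEnvelope_ge hB hR hx₁R (mem_ball_zero_iff.1 hxR).le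
    rw [hxΓ]
    linarith
  obtain ⟨p, hp⟩ := exists_supporting_plane hB
    (Metric.ball_subset_ball (by linarith : R ≤ 3 * R) hxR)
  -- At a contact point the supporting plane of `Γ` passes through `u x`, so it touches `u` from
  -- above.
  rw [← hxΓ] at hp
  have hp' : ∀ y ∈ Metric.ball (0 : E n) (3 * R), u y ≤ u x + inner ℝ p (y - x) :=
    fun y hy => (le_max_left _ _).trans (hp y hy)
  have hT := r0_pos n σ₁ hR
  have hTR := r0_le n (h12.trans_lt h2) hR
  obtain ⟨k, hk⟩ := exists_good_ring h ha h1 (h1.trans_le h12) h2 hlam hl hR hsub hout hxR hux hp'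
    hT hTR
  refine ⟨k, fun c hc => ?_⟩
  have e : r0 n σ₁ R / (16 * Real.sqrt n) / 2 ^ k = r0 n σ₁ R / 2 ^ k / (16 * Real.sqrt n) :=
    div_right_comm _ _ _
  rw [e] at hc ⊢
  have hA : 0 < scaleFactor n φ σ₁ R :=
    div_pos (by linarith [h.lowerC_pos h2 one_pos, h.upperC_nonneg]) (h.lowerC_pos h2 hT)
  exact isGoodCube_of_ring hB (by positivity)
    ((div_le_self hT.le (one_le_pow₀ (by norm_num))).trans hTR) hxR hp hA (ringConst_pos n hlam ha)
    (rhs_pos h ha h1 h2 hlam hl hR hsub hout hxR hux hp') hf hk hc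

end Main

end NonlocalABP

theorem theoremt (n : ℕ) [NeZero n] :
    ∃ μ : ℝ, μ ∈ Set.Ioo (0 : ℝ) 1 ∧
    ∀ lam a : ℝ, 0 < lam → 1 ≤ a →
    ∃ C : ℝ, 0 < C ∧
    ∀ (Lam σ₁ σ₂ : ℝ) (φ : ℝ → ℝ), lam ≤ Lam → 0 < σ₁ → σ₁ ≤ σ₂ → σ₂ < 2 →
      NonlocalABP.WeakScaling φ a σ₁ σ₂ →
    ∀ (R : ℝ) (u f : NonlocalABP.E n → ℝ), 0 < R →
      BddAbove (f '' Metric.ball 0 R) →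
      NonlocalABP.IsViscositySubsolution (NonlocalABP.maxOp φ lam Lam) (fun x => -f x)
        (Metric.ball 0 R) u →
      (∀ x, x ∉ Metric.ball (0 : NonlocalABP.E n) R → u x ≤ 0) →
      (∃ x, 0 < u x) →
    ∃ (m : ℕ) (c : Fin m → NonlocalABP.E n) (s : Fin m → ℝ),
      (∀ j, 0 < s j) ∧
      (∀ i j, i ≠ j →
        Disjoint (NonlocalABP.cube (c i) (s i)) (NonlocalABP.cube (c j) (s j))) ∧
      (∀ j, Metric.diam (NonlocalABP.cube (c j) (s j)) ≤ NonlocalABP.r0 n σ₁ R) ∧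
      (∀ j, (NonlocalABP.contactSet u R ∩ closure (NonlocalABP.cube (c j) (s j))).Nonempty) ∧
      (NonlocalABP.contactSet u R ⊆ ⋃ j, closure (NonlocalABP.cube (c j) (s j))) ∧
      (∀ j,
        MeasureTheory.volume
          (NonlocalABP.gradImage (NonlocalABP.concaveEnvelope u R) (Metric.ball 0 (3 * R))
            (closure (NonlocalABP.cube (c j) (s j)))) ≤
        ENNReal.ofReal (C * (NonlocalABP.scaleFactor n φ σ₁ R *
            sSup (f '' (closure (NonlocalABP.cube (c j) (s j)) ∩ Metric.ball 0 R))) ^ n) *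
          MeasureTheory.volume (NonlocalABP.cube (c j) (s j))) ∧
      (∀ j,
        ENNReal.ofReal μ * MeasureTheory.volume (NonlocalABP.cube (c j) (s j)) ≤
        MeasureTheory.volume
          {y | y ∈ NonlocalABP.cube (c j) (32 * Real.sqrt n * s j) ∧
            NonlocalABP.concaveEnvelope u R y -
              C * NonlocalABP.scaleFactor n φ σ₁ R *
                sSup (f '' (closure (NonlocalABP.cube (c j) (s j)) ∩ Metric.ball 0 R)) *
                Metric.diam (NonlocalABP.cube (c j) (s j)) ^ 2 < u y}) := by
  refine ⟨1 / 2, by norm_num, fun lam a hlam ha => ⟨NonlocalABP.abpConst n lam a,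
    NonlocalABP.abpConst_pos n hlam ha, ?_⟩⟩
  intro Lam σ₁ σ₂ φ hl h1 h12 h2 h R u f hR hf hsub hout hpos
  obtain ⟨B, hB⟩ := hsub.bounded
  have hn : (0 : ℝ) < n := by exact_mod_cast NeZero.pos n
  have hsn : 0 < Real.sqrt n := Real.sqrt_pos.2 hn
  have hT := NonlocalABP.r0_pos n σ₁ hR
  obtain ⟨m, c, s, hs, hdisj, hne, hcov, hgood⟩ := NonlocalABP.exists_good_dyadic_cover
    (NonlocalABP.isCompact_contactSet hB hR hsub.usc hout hpos)
    (by positivity : 0 < NonlocalABP.r0 n σ₁ R / (16 * Real.sqrt n))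
    (fun x hx => NonlocalABP.exists_isGoodCube h ha h1 h12 h2 hlam hl hR hf hsub hout hpos hx)
  refine ⟨m, c, s, fun j => (hs j).1, hdisj, fun j => ?_, hne, hcov, fun j => (hgood j).1,
    fun j => (hgood j).2⟩
  calc Metric.diam (NonlocalABP.cube (c j) (s j)) ≤ Real.sqrt n * s j :=
        NonlocalABP.diam_cube_le _ (hs j).1.le
    _ ≤ Real.sqrt n * (NonlocalABP.r0 n σ₁ R / (16 * Real.sqrt n)) := by
        gcongr
        exact (hs j).2
    _ = NonlocalABP.r0 n σ₁ R / 16 := by field_simp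
    _ ≤ NonlocalABP.r0 n σ₁ R := by linarith
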